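/- Fix a finite input set $I$ with $k=|I|$ and an output set $O$. A finite state machine (FSM) is a Mealy machine with finitely many states and an initial state; two FSMs are equivalent if they give equal output sequences on all input sequences. Let $\mathbb I$ be a list of $i$ black-box implementations, each an FSM. Consider two algorithms, both with a perfect teacher that answers an output query (OQ) with the output sequence of the implementation, and an equivalence query (EQ) for a model either by "yes", if it is equivalent to the implementation, or by an arbitrary counterexample, i.e. an input sequence on which the outputs differ. (a) Repeated $L^{\#}$ starts with $\mathbb M=\emptyset$, learns every implementation from scratch with the algorithm $L^{\#}$, and adds the learned model to $\mathbb M$ unless an equivalent model is already there, in which case that model is assigned to the implementation. (b) IncrementalFingerprinting with SepSeq and $L^{\#}$ starts with a finite set $\mathbb M=\mathbb M_0$ of pairwise inequivalent models and treats the implementations one after the other. If $\mathbb M\neq\emptyset$, it chooses one separating sequence for every pair of models in $\mathbb M$ and executes these sequences on the implementation, in any order, until at most one model of $\mathbb M$ agrees with all answers; if one model remains, one EQ (conformance query) is posed for it, and if this passes, the model is assigned to the implementation. In all other cases a model is learned with $L^{\#}$, assigned and added to $\mathbb M$; the observation tree of $L^{\#}$ may be initialised with any part of the executed fingerprinting sequences.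 Here $L^{\#}$ poses an EQ only if its basis is complete, all frontier states are identified, and the hypothesis agrees with the observation tree; all its other choices are free. Then every run of either algorithm terminates, with a set $\mathbb M$ of pairwise inequivalent models, consisting of the initial references and of models equivalent to implementations, and with a map $\mu:\mathbb I\to\mathbb M$ such that, for every implementation $\mathcal I$ in $\mathbb I$ and every $\mathcal M\in\mathbb M$, $\mu(\mathcal I)=\mathcal M$ if and only if $\mathcal I$ and $\mathcal M$ are equivalent. Moreover there is an absolute constant $C$ with the following property. Let $m=|\mathbb M|$ for the final set $\mathbb M$, let every model in $\mathbb M$ have at most $n$ states, and let all counterexamples returned to $L^{\#}$ in the run have length at most $l$; in (b), let moreover all fingerprinting sequences with which $L^{\#}$ was initialised have length at most $\max(l,2n)$ (this holds automatically if $L^{\#}$ learns from scratch, or if shortest separating sequences are used). Then, with $n\log l$ read as $0$ for $l=0$: 1. Repeated $L^{\#}$ uses at most $C\, i\,(kn^2+n\log l)$ OQs and at most $in$ EQs. 2. IncrementalFingerprinting with SepSeq and $L^{\#}$ uses at most $C\,\bigl(m(kn^2+n\log l)+im^2\bigr)$ OQs and at most $mn+i$ EQs. -/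

import Mathlib

universe u v

namespace IncFp

/-! ### Finite state machines -/

/-- Finite state machines (Mealy machines) over inputs `I` and outputs `O`. -/
structure FSM (I : Type u) (O : Type v) where
  Q : Type u
  finite_Q : Finite Q
  q0 : Q
  next : Q → I → Q
  out : Q → I → O

variable {I : Type u} {O : Type v}

namespace FSM

/-- The number of states `|M|`. -/
noncomputable def size (M : FSM I O) : ℕ := Nat.card M.Q

/-- The transition function extended to input sequences. -/
def nextStar (M : FSM I O) : M.Q → List I → M.Q
  | q, [] => q
  | q, i :: w => M.nextStar (M.next q i) w

/-- The output function extended to input sequences. -/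
def outStar (M : FSM I O) : M.Q → List I → List O
  | _, [] => []
  | q, i :: w => M.out q i :: M.outStar (M.next q i) w

/-- The output sequence produced from the initial state. -/
def output (M : FSM I O) (w : List I) : List O := M.outStar M.q0 w

/-- Equivalence of machines: equal outputs on all input sequences. -/
def Equivalent (M N : FSM I O) : Prop := ∀ w : List I, M.output w = N.output w

/-- `w` is a separating sequence for `M` and `N`. -/
def Separates (w : List I) (M N : FSM I O) : Prop := M.output w ≠ N.output w

end FSM

/-! ### Observation trees

An observation tree is a partial map: `T w = some o` if the input sequence `w` has been observed,
with output sequence `o`.  The observed sequences are the states of the tree, the root is `[]`, and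
the access sequence of a state is the state itself. -/

/-- Observation trees. -/
abbrev ObsTree (I : Type u) (O : Type v) := List I → Option (List O)

namespace ObsTree

open Classical in
/-- The tree that has only a root. -/
noncomputable def root : ObsTree I O := fun w => if w = [] then some [] else none

open Classical in
/-- Add the observation that input `w` (and hence each of its prefixes) produces output `o`. -/
noncomputable def observe (T : ObsTree I O) (w : List I) (o : List O) : ObsTree I O :=
  fun x => if x <+: w then some (o.take x.length) else T x

/-- The tree that contains exactly the observations of the sequences in `L` on the machine `M`. -/
noncomputable def ofLog (M : FSM I O) (L : List (List I)) : ObsTree I O :=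
  L.foldl (fun T w => T.observe w (M.output w)) root

/-- `σ` is a witness for the apartness of the tree states `p` and `q`: it can be followed in the
tree from both states, and the outputs along it differ. -/
def Witness (T : ObsTree I O) (p q σ : List I) : Prop :=
  ∃ a b : List O, T (p ++ σ) = some a ∧ T (q ++ σ) = some b ∧
    a.drop p.length ≠ b.drop q.length

/-- Apartness of tree states. -/
def Apart (T : ObsTree I O) (p q : List I) : Prop := ∃ σ, T.Witness p q σ

/-- The frontier of the basis `S`: the immediate successors of basis states outside the basis. -/
def IsFrontier (T : ObsTree I O) (S : Finset (List I)) (w : List I) : Prop :=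
  w ∉ S ∧ T w ≠ none ∧ ∃ q ∈ S, ∃ i : I, w = q ++ [i]

end ObsTree

/-! ### The learning algorithm `L#` -/

/-- A hypothesis: a machine whose states are basis states of the observation tree. -/
structure Hyp (I : Type u) (O : Type v) where
  basis : Finset (List I)
  root_mem : [] ∈ basis
  next : {q // q ∈ basis} → I → {q // q ∈ basis}
  out : {q // q ∈ basis} → I → O

namespace Hyp

/-- The machine given by a hypothesis. -/
def toFSM (H : Hyp I O) : FSM I O where
  Q := {q // q ∈ H.basis}
  finite_Q := inferInstance
  q0 := ⟨[], H.root_mem⟩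
  next := H.next
  out := H.out

/-- The basis state (i.e. its access sequence) reached in the hypothesis by `w`. -/
def reach (H : Hyp I O) (w : List I) : List I :=
  (H.toFSM.nextStar H.toFSM.q0 w : {q // q ∈ H.basis}).1

/-- `H` is a hypothesis for the basis `S` of the tree `T`: its states are those of the basis, its
outputs are the observed ones, a transition to a basis state is kept, and a transition to a
frontier state is redirected to a basis state that is not apart from it. -/
def IsFor (H : Hyp I O) (S : Finset (List I)) (T : ObsTree I O) : Prop :=
  H.basis = S ∧
  ∀ (q : {q // q ∈ H.basis}) (i : I),
    (∃ o : List O, T (q.1 ++ [i]) = some (o ++ [H.out q i])) ∧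
    (q.1 ++ [i] ∈ S → (H.next q i).1 = q.1 ++ [i]) ∧
    (q.1 ++ [i] ∉ S → ¬ T.Apart (q.1 ++ [i]) (H.next q i).1)

end Hyp

/-- What `L#` is doing: applying its rules, processing a counterexample `σ` for `H`, or it has
terminated and returned `H`. -/
inductive LMode (I : Type u) (O : Type v)
  | explore
  | search (H : Hyp I O) (σ : List I)
  | done (H : Hyp I O)

/-- Configurations of `L#`: basis, observation tree, mode, the numbers of output and equivalence
queries posed so far, and the counterexamples received from the teacher so far. -/
structure LConfig (I : Type u) (O : Type v) where
  basis : Finset (List I)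
  tree : ObsTree I O
  mode : LMode I O
  oq : ℕ
  eq : ℕ
  ces : List (List I)

namespace LConfig

/-- The start of `L#` on `M`, with a tree initialised with the already executed sequences `L`
(`L = []` is learning from scratch). -/
noncomputable def init (M : FSM I O) (L : List (List I)) : LConfig I O where
  basis := {[]}
  tree := ObsTree.ofLog M L
  mode := .explore
  oq := 0
  eq := 0
  ces := []

/-- Pose the output query `w` to a teacher for `M`. -/
noncomputable def query (M : FSM I O) (c : LConfig I O) (w : List I) : LConfig I O :=
  { c with tree := c.tree.observe w (M.output w), oq := c.oq + 1 }

/-- `w` is a frontier state. -/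
def Frontier (c : LConfig I O) (w : List I) : Prop := c.tree.IsFrontier c.basis w

/-- The basis is complete and every frontier state is identified, i.e. apart from all basis states
but exactly one.  Hypotheses are only built if this holds. -/
def Settled (c : LConfig I O) : Prop :=
  (∀ q ∈ c.basis, ∀ i : I, c.tree (q ++ [i]) ≠ none) ∧
  ∀ q, c.Frontier q → ∃! p, p ∈ c.basis ∧ ¬ c.tree.Apart q p

/-- `H` is a hypothesis that may be built in `c`. -/
def Builds (c : LConfig I O) (H : Hyp I O) : Prop :=
  c.mode = .explore ∧ c.Settled ∧ H.IsFor c.basis c.tree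

/-- `σ` leads to apart states in the hypothesis and in the tree. -/
def Conflict (c : LConfig I O) (H : Hyp I O) (σ : List I) : Prop :=
  c.tree σ ≠ none ∧ c.tree.Apart (H.reach σ) σ

end LConfig

open Classical in
/-- One step of `L#` with a perfect teacher for the machine `M`.  The choice of the rule, of its
parameters, of the witnesses, and of the counterexamples given by the teacher is free. -/
inductive LStep (M : FSM I O) : LConfig I O → LConfig I O → Prop
  /-- An isolated frontier state is moved to the basis. -/
  | promote (c : LConfig I O) (q : List I) :
      c.mode = .explore → c.Frontier q → (∀ p ∈ c.basis, c.tree.Apart q p) →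
      LStep M c { c with basis := insert q c.basis }
  /-- A missing transition of a basis state is explored. -/
  | extend (c : LConfig I O) (q : List I) (i : I) :
      c.mode = .explore → q ∈ c.basis → c.tree (q ++ [i]) = none →
      LStep M c (c.query M (q ++ [i]))
  /-- A frontier state that is not apart from two basis states is tested with a witness for these. -/
  | identify (c : LConfig I O) (q r r' σ : List I) :
      c.mode = .explore → c.Frontier q → r ∈ c.basis → r' ∈ c.basis → r ≠ r' →
      ¬ c.tree.Apart q r → ¬ c.tree.Apart q r' → c.tree.Witness r r' σ →
      LStep M c (c.query M (q ++ σ))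
  /-- The hypothesis contradicts the tree. -/
  | inconsistent (c : LConfig I O) (H : Hyp I O) (σ : List I) :
      c.Builds H → c.Conflict H σ →
      LStep M c { c with mode := .search H σ }
  /-- The hypothesis agrees with the tree, and the equivalence query is answered with `yes`. -/
  | accept (c : LConfig I O) (H : Hyp I O) :
      c.Builds H → (∀ σ, ¬ c.Conflict H σ) → H.toFSM.Equivalent M →
      LStep M c { c with mode := .done H, eq := c.eq + 1 }
  /-- The hypothesis agrees with the tree, and the equivalence query is answered with the
  counterexample `ρ`.  This is posed as an output query, and its shortest prefix `σ` that leads to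
  a conflict is processed. -/
  | refute (c : LConfig I O) (H : Hyp I O) (ρ σ : List I) :
      c.Builds H → (∀ σ, ¬ c.Conflict H σ) → H.toFSM.output ρ ≠ M.output ρ →
      σ <+: ρ → (c.query M ρ).Conflict H σ →
      (∀ τ, τ <+: ρ → τ.length < σ.length → ¬ (c.query M ρ).Conflict H τ) →
      LStep M c { c.query M ρ with mode := .search H σ, eq := c.eq + 1, ces := ρ :: c.ces }
  /-- Counterexample processing ends at a state of the basis or the frontier. -/
  | finish (c : LConfig I O) (H : Hyp I O) (σ : List I) :
      c.mode = .search H σ → (σ ∈ c.basis ∨ c.Frontier σ) →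
      LStep M c { c with mode := .explore }
  /-- Binary search.  `σ` is split into `σ₁` and `σ₂`, halfway between its prefix `ρ` in the
  frontier and its end; `η` is a witness for the conflict at `σ`. -/
  | split (c : LConfig I O) (H : Hyp I O) (σ ρ σ₁ σ₂ η σ' : List I) (c' : LConfig I O) :
      c.mode = .search H σ → ¬ (σ ∈ c.basis ∨ c.Frontier σ) →
      c.Frontier ρ → ρ <+: σ →
      σ₁ = σ.take ((ρ.length + σ.length) / 2) → σ₂ = σ.drop ((ρ.length + σ.length) / 2) →
      c.tree.Witness (H.reach σ) σ η →
      c' = c.query M (H.reach σ₁ ++ σ₂ ++ η) →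
      σ' = (if c'.tree.Apart (H.reach σ₁) σ₁ then σ₁ else H.reach σ₁ ++ σ₂) →
      LStep M c { c' with mode := .search H σ' }

/-! ### Fingerprinting with separating sequences (`SepSeq`) -/

/-- `F` lists, in some order, a fingerprint for the models `Ms` that consists of one separating
sequence for every pair of inequivalent models. -/
def IsSepSeq (Ms : List (FSM I O)) (F : List (List I)) : Prop :=
  F.Nodup ∧ ∃ s : FSM I O → FSM I O → List I,
    (∀ M N, s M N = s N M) ∧
    (∀ M ∈ Ms, ∀ N ∈ Ms, ¬ M.Equivalent N → FSM.Separates (s M N) M N) ∧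
    ∀ w, w ∈ F ↔ ∃ M ∈ Ms, ∃ N ∈ Ms, ¬ M.Equivalent N ∧ w = s M N

open Classical in
/-- Run the sequences in `F` on the implementation `A` one after the other until at most one of the
models `Ms` agrees with all answers.  The result is the list of remaining models and the list of
executed sequences. -/
noncomputable def runFingerprint (A : FSM I O) :
    List (FSM I O) → List (List I) → List (FSM I O) × List (List I)
  | Ms, [] => (Ms, [])
  | Ms, w :: F =>
    if Ms.length ≤ 1 then (Ms, [])
    else
      let r := runFingerprint A (Ms.filter fun M => decide (M.output w = A.output w)) F
      (r.1, w :: r.2)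

/-! ### The two algorithms for lists of implementations -/

/-- What is being done with the first implementation of the to-do list: nothing yet, a conformance
query for the model `M` is about to be posed after the sequences `L` were executed, `L#` is about
to be called after the sequences `L` were executed, or `L#` is running. -/
inductive Phase (I : Type u) (O : Type v)
  | idle
  | check (M : FSM I O) (L : List (List I))
  | call (L : List (List I))
  | learn (c : LConfig I O)

/-- States of a run: the implementations still to be treated, the set of models (as a list), the
models assigned to the implementations that have been treated (in order), the phase, the numbers of
output and equivalence queries, the counterexamples received, and the executed fingerprinting
sequences that were used to initialise the tree of `L#`.  The queries and counterexamples of a call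
of `L#` are added when that call returns. -/
structure RunState (I : Type u) (O : Type v) where
  todo : List (FSM I O)
  models : List (FSM I O)
  assigned : List (FSM I O)
  phase : Phase I O
  oq : ℕ
  eq : ℕ
  ces : List (List I)
  reused : List (List I)

namespace RunState

/-- The start for the implementations `As` and the initial references `M₀`. -/
def start (As M₀ : List (FSM I O)) : RunState I O where
  todo := As
  models := M₀
  assigned := []
  phase := .idle
  oq := 0
  eq := 0
  ces := []
  reused := []

/-- Assign the model `M` to the current implementation and go on to the next one. -/
def assign (s : RunState I O) (M : FSM I O) : RunState I O :=
  { s with todo := s.todo.tail, assigned := s.assigned ++ [M], phase := .idle }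

/-- Add the costs of a terminated call of `L#`. -/
def charge (s : RunState I O) (c : LConfig I O) : RunState I O :=
  { s with oq := s.oq + c.oq, eq := s.eq + c.eq, ces := c.ces ++ s.ces }

end RunState

/-- One step of repeated `L#` with a perfect teacher: each implementation is learned from scratch,
and the learned model is added if it is not equivalent to any model in the set. -/
inductive RepeatStep : RunState I O → RunState I O → Prop
  | start (s : RunState I O) (A : FSM I O) (As : List (FSM I O)) :
      s.phase = .idle → s.todo = A :: As →
      RepeatStep s { s with phase := .learn (LConfig.init A []) }
  | learn (s : RunState I O) (A : FSM I O) (As : List (FSM I O)) (c c' : LConfig I O) :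
      s.phase = .learn c → s.todo = A :: As → LStep A c c' →
      RepeatStep s { s with phase := .learn c' }
  | add (s : RunState I O) (c : LConfig I O) (H : Hyp I O) :
      s.phase = .learn c → c.mode = .done H → (∀ M ∈ s.models, ¬ M.Equivalent H.toFSM) →
      RepeatStep s ({ s.charge c with models := s.models ++ [H.toFSM] }.assign H.toFSM)
  | known (s : RunState I O) (c : LConfig I O) (H : Hyp I O) (M : FSM I O) :
      s.phase = .learn c → c.mode = .done H → M ∈ s.models → M.Equivalent H.toFSM →
      RepeatStep s ((s.charge c).assign M)

/-- One step of `IncrementalFingerprinting` with `SepSeq` for fingerprinting, `L#` for learning and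
perfect teachers for conformance and equivalence queries. -/
inductive IncStep : RunState I O → RunState I O → Prop
  /-- There are no models yet. -/
  | first (s : RunState I O) (A : FSM I O) (As : List (FSM I O)) :
      s.phase = .idle → s.todo = A :: As → s.models = [] →
      IncStep s { s with phase := .call [] }
  /-- Fingerprinting returns no model. -/
  | fpNone (s : RunState I O) (A : FSM I O) (As : List (FSM I O)) (F L : List (List I)) :
      s.phase = .idle → s.todo = A :: As → s.models ≠ [] → IsSepSeq s.models F →
      runFingerprint A s.models F = ([], L) →
      IncStep s { s with phase := .call L, oq := s.oq + L.length }
  /-- Fingerprinting returns the model `M`. -/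
  | fpSome (s : RunState I O) (A : FSM I O) (As : List (FSM I O)) (F L : List (List I))
      (M : FSM I O) :
      s.phase = .idle → s.todo = A :: As → s.models ≠ [] → IsSepSeq s.models F →
      runFingerprint A s.models F = ([M], L) →
      IncStep s { s with phase := .check M L, oq := s.oq + L.length }
  /-- The conformance query passes. -/
  | pass (s : RunState I O) (A : FSM I O) (As : List (FSM I O)) (M : FSM I O)
      (L : List (List I)) :
      s.phase = .check M L → s.todo = A :: As → A.Equivalent M →
      IncStep s ({ s with eq := s.eq + 1 }.assign M)
  /-- The conformance query fails. -/
  | fail (s : RunState I O) (A : FSM I O) (As : List (FSM I O)) (M : FSM I O)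
      (L : List (List I)) :
      s.phase = .check M L → s.todo = A :: As → ¬ A.Equivalent M →
      IncStep s { s with phase := .call L, eq := s.eq + 1 }
  /-- `L#` is called; any part `L'` of the executed sequences, from none to all, may be used to
  initialise its tree. -/
  | call (s : RunState I O) (A : FSM I O) (As : List (FSM I O)) (L L' : List (List I)) :
      s.phase = .call L → s.todo = A :: As → L' ⊆ L →
      IncStep s { s with phase := .learn (LConfig.init A L'), reused := L' ++ s.reused }
  | learn (s : RunState I O) (A : FSM I O) (As : List (FSM I O)) (c c' : LConfig I O) :
      s.phase = .learn c → s.todo = A :: As → LStep A c c' →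
      IncStep s { s with phase := .learn c' }
  | add (s : RunState I O) (c : LConfig I O) (H : Hyp I O) :
      s.phase = .learn c → c.mode = .done H →
      IncStep s ({ s.charge c with models := s.models ++ [H.toFSM] }.assign H.toFSM)

/-! ### Correctness -/

/-- Every run from `s₀` terminates. -/
def Terminates {α : Type*} (Step : α → α → Prop) (s₀ : α) : Prop :=
  ¬ ∃ f : ℕ → α, f 0 = s₀ ∧ ∀ t, Step (f t) (f (t + 1))

/-- `s` is the last state of a maximal run from `s₀`. -/
def EndsIn {α : Type*} (Step : α → α → Prop) (s₀ s : α) : Prop :=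
  Relation.ReflTransGen Step s₀ s ∧ ∀ s', ¬ Step s s'

/-- The models `Ms` and the map `μ` (the list of the models assigned to the members of `As`) solve
the open-world fingerprinting problem for the implementations `As` and the initial references `M₀`:
the models are pairwise inequivalent, they are the references together with models of
implementations, and `μ` assigns to each implementation the model equivalent to it. -/
structure Solves (As M₀ Ms μ : List (FSM I O)) : Prop where
  distinct : Ms.Pairwise fun M N => ¬ M.Equivalent N
  references : M₀ ⊆ Ms
  sound : ∀ M ∈ Ms, M ∈ M₀ ∨ ∃ A ∈ As, A.Equivalent M
  assigned : List.Forall₂ (fun A N => N ∈ Ms ∧ ∀ M ∈ Ms, N = M ↔ A.Equivalent M) As μ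

/-- The run has treated all implementations and its result is correct. -/
def Correct (As M₀ : List (FSM I O)) (s : RunState I O) : Prop :=
  s.todo = [] ∧ s.phase = .idle ∧ Solves As M₀ s.models s.assigned

end IncFp

open IncFp

/-! All that `L#` observes is behaviour of the implementation, and its basis states are pairwise
apart, hence have pairwise different responses. So the basis never outgrows any machine equivalent
to the implementation, in particular the model finally assigned to it (`LConfig.Inv.card_le`).

A query outside counterexample processing reveals a new transition of the basis, or a new apartness
between the target of such a transition and a basis state; there are at most `kn + kn²` such facts.
A search for a conflict halves the distance to the frontier with every query (`LConfig.Inv.split`)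
and ends at a frontier state apart from the whole basis (`LConfig.Inv.isolated`). While such a state
exists no hypothesis can be built, so the basis grows between two searches, and again before
acceptance. Hence there are fewer than `n` searches, and at most `n` EQs, as every negative answer
opens a search (`LStep.cost`).

A search costs about the logarithm of the longest observation. That length is at most `max(l, 2n)`
plus `n` per query (`LStep.length_le`), so the number `Q` of queries enters its own bound, but only
through `n log(1 + Q)`, which is at most a small multiple of `Q` plus `O(n²)` (`query_bound`).

`L#` terminates because basis and knowledge are bounded and only finitely many steps leave both
unchanged (`LConfig.Inv.acc`); it is never stuck (`LConfig.Inv.exists_step`), so it stops only with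
an accepted hypothesis.

Fingerprinting never discards a model equivalent to the implementation, and two survivors of all
tests would agree on their own separating sequence. So `L#` is called only if no model is equivalent
to the implementation, each call adds a new model, and there are at most `m` calls. To this come at
most `m²` fingerprinting queries and one conformance query per implementation. -/

namespace IncFp

variable {I : Type u} {O : Type v}

/-! ### Responses of a machine after an input prefix -/

namespace FSM

theorem nextStar_append (M : FSM I O) (q : M.Q) (u v : List I) :
    M.nextStar q (u ++ v) = M.nextStar (M.nextStar q u) v := by
  induction u generalizing q with
  | nil => rfl
  | cons a u ih => exact ih _

theorem outStar_append (M : FSM I O) (q : M.Q) (u v : List I) :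
    M.outStar q (u ++ v) = M.outStar q u ++ M.outStar (M.nextStar q u) v := by
  induction u generalizing q with
  | nil => rfl
  | cons a u ih => simp [outStar, nextStar, ih]

theorem length_outStar (M : FSM I O) (q : M.Q) (u : List I) :
    (M.outStar q u).length = u.length := by
  induction u generalizing q with
  | nil => rfl
  | cons a u ih => simp [outStar, ih]

theorem length_output (M : FSM I O) (u : List I) : (M.output u).length = u.length :=
  M.length_outStar _ u

/-- The response to `σ` of the machine after it has processed `p`. -/
def resp (M : FSM I O) (p σ : List I) : List O := M.outStar (M.nextStar M.q0 p) σ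

theorem output_append (M : FSM I O) (p σ : List I) :
    M.output (p ++ σ) = M.output p ++ M.resp p σ :=
  M.outStar_append _ p σ

theorem resp_append (M : FSM I O) (p σ τ : List I) :
    M.resp p (σ ++ τ) = M.resp p σ ++ M.resp (p ++ σ) τ := by
  simp [resp, outStar_append, nextStar_append]

theorem length_resp (M : FSM I O) (p σ : List I) : (M.resp p σ).length = σ.length :=
  M.length_outStar _ σ

theorem drop_output (M : FSM I O) (p σ : List I) :
    (M.output (p ++ σ)).drop p.length = M.resp p σ := by
  rw [output_append, ← M.length_output p, List.drop_left]

theorem take_output (M : FSM I O) {p w : List I} (h : p <+: w) :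
    (M.output w).take p.length = M.output p := by
  obtain ⟨σ, rfl⟩ := h
  rw [output_append, ← M.length_output p, List.take_left]

theorem Equivalent.symm {M N : FSM I O} (h : M.Equivalent N) : N.Equivalent M :=
  fun w => (h w).symm

theorem Equivalent.trans {M N P : FSM I O} (h : M.Equivalent N) (h' : N.Equivalent P) :
    M.Equivalent P :=
  fun w => (h w).trans (h' w)

theorem Equivalent.resp_eq {M N : FSM I O} (h : M.Equivalent N) (p σ : List I) :
    M.resp p σ = N.resp p σ := by
  rw [← drop_output, ← drop_output, h]

/-- Input sequences with pairwise different responses are no more than the states. -/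
theorem card_le_size (M : FSM I O) (S : Finset (List I))
    (h : ∀ p ∈ S, ∀ q ∈ S, p ≠ q → ∃ σ, M.resp p σ ≠ M.resp q σ) : S.card ≤ M.size := by
  have := M.finite_Q
  have hinj : Function.Injective fun p : {p // p ∈ S} => M.nextStar M.q0 p.1 := by
    intro p q hpq
    by_contra hne
    obtain ⟨σ, hσ⟩ := h p.1 p.2 q.1 q.2 fun h => hne (Subtype.ext h)
    exact hσ (congrArg (fun s => M.outStar s σ) hpq)
  simpa [size] using Nat.card_le_card_of_injective _ hinj

end FSM

/-! ### Observation trees that are sound for a machine -/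

namespace ObsTree

/-- `T` is a tree of observations of the machine `M`. -/
structure Valid (M : FSM I O) (T : ObsTree I O) : Prop where
  root : T [] ≠ none
  sound : ∀ w o, T w = some o → o = M.output w
  closed : ∀ w v, T (w ++ v) ≠ none → T w ≠ none

theorem Valid.eq_some {M : FSM I O} {T : ObsTree I O} (hT : T.Valid M) {w : List I}
    (h : T w ≠ none) : T w = some (M.output w) := by
  obtain ⟨o, ho⟩ := Option.ne_none_iff_exists'.1 h
  rw [ho, hT.sound w o ho]

theorem valid_root (M : FSM I O) : (root : ObsTree I O).Valid M where
  root := by simp [root]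
  sound w o h := by
    unfold ObsTree.root at h
    split_ifs at h with hw
    subst hw
    simpa [FSM.output, FSM.outStar] using h.symm
  closed w v h := by
    unfold ObsTree.root at h ⊢
    split_ifs at h with hw
    · simp_all
    · exact absurd rfl h

theorem observe_ne_none {M : FSM I O} {T : ObsTree I O} {w x : List I} :
    T.observe w (M.output w) x ≠ none ↔ x <+: w ∨ T x ≠ none := by
  unfold observe
  split_ifs with h <;> simp [h]

theorem Valid.observe {M : FSM I O} {T : ObsTree I O} (hT : T.Valid M) (w : List I) :
    (T.observe w (M.output w)).Valid M where
  root := observe_ne_none.2 (.inr hT.root)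
  sound x o h := by
    unfold ObsTree.observe at h
    split_ifs at h with hx
    · rw [M.take_output hx] at h
      exact (Option.some.inj h).symm
    · exact hT.sound x o h
  closed x v h := by
    rcases observe_ne_none.1 h with h | h
    · exact observe_ne_none.2 (.inl ((List.prefix_append x v).trans h))
    · exact observe_ne_none.2 (.inr (hT.closed x v h))

theorem valid_foldl (M : FSM I O) (L : List (List I)) {T : ObsTree I O} (hT : T.Valid M) :
    (L.foldl (fun T w => T.observe w (M.output w)) T).Valid M := by
  induction L generalizing T with
  | nil => exact hT
  | cons w L ih => exact ih (hT.observe w)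

theorem valid_ofLog (M : FSM I O) (L : List (List I)) : (ofLog M L).Valid M :=
  valid_foldl M L (valid_root M)

theorem length_le_of_foldl (M : FSM I O) {l : ℕ} (L : List (List I)) (hL : ∀ w ∈ L, w.length ≤ l)
    {T : ObsTree I O} (hT : ∀ w, T w ≠ none → w.length ≤ l) :
    ∀ w, L.foldl (fun T w => T.observe w (M.output w)) T w ≠ none → w.length ≤ l := by
  induction L generalizing T with
  | nil => exact hT
  | cons x L ih =>
    refine ih (fun w hw => hL w (by simp [hw])) fun w hw => ?_
    rcases observe_ne_none.1 hw with h | h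
    · exact h.length_le.trans (hL x (by simp))
    · exact hT w h

theorem length_le_of_ofLog (M : FSM I O) {l : ℕ} (L : List (List I))
    (hL : ∀ w ∈ L, w.length ≤ l) : ∀ w, ofLog M L w ≠ none → w.length ≤ l := by
  refine length_le_of_foldl M L hL fun w hw => ?_
  unfold root at hw
  split_ifs at hw with h <;> simp_all

/-- The tree stores outputs from the root. Dropping the part produced by the access sequence leaves
the response of `M`, so apartness becomes a statement about `M` on observed sequences. -/
theorem Valid.witness_iff {M : FSM I O} {T : ObsTree I O} (hT : T.Valid M) {p q σ : List I} :
    T.Witness p q σ ↔ T (p ++ σ) ≠ none ∧ T (q ++ σ) ≠ none ∧ M.resp p σ ≠ M.resp q σ := by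
  constructor
  · rintro ⟨a, b, ha, hb, hab⟩
    rw [hT.sound _ _ ha, hT.sound _ _ hb, M.drop_output, M.drop_output] at hab
    exact ⟨by simp [ha], by simp [hb], hab⟩
  · rintro ⟨ha, hb, hab⟩
    refine ⟨_, _, hT.eq_some ha, hT.eq_some hb, ?_⟩
    rwa [M.drop_output, M.drop_output]

theorem Valid.apart_iff {M : FSM I O} {T : ObsTree I O} (hT : T.Valid M) {p q : List I} :
    T.Apart p q ↔
      ∃ σ, T (p ++ σ) ≠ none ∧ T (q ++ σ) ≠ none ∧ M.resp p σ ≠ M.resp q σ :=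
  exists_congr fun _ => hT.witness_iff

theorem Apart.symm {T : ObsTree I O} {p q : List I} (h : T.Apart p q) : T.Apart q p := by
  obtain ⟨σ, a, b, ha, hb, hab⟩ := h
  exact ⟨σ, b, a, hb, ha, hab.symm⟩

theorem Valid.not_apart_self {M : FSM I O} {T : ObsTree I O} (hT : T.Valid M) (p : List I) :
    ¬ T.Apart p p := by
  rw [hT.apart_iff]
  rintro ⟨σ, -, -, h⟩
  exact h rfl

theorem Valid.resp_eq {M : FSM I O} {T : ObsTree I O} (hT : T.Valid M) {p q σ : List I}
    (h : ¬ T.Apart p q) (hp : T (p ++ σ) ≠ none) (hq : T (q ++ σ) ≠ none) :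
    M.resp p σ = M.resp q σ := by
  by_contra hne
  exact h (hT.apart_iff.2 ⟨σ, hp, hq, hne⟩)

/-- Observing the witness for the apartness of `r` and `r'` from `q` makes `q` apart from one of
them. -/
theorem Valid.apart_or_apart {M : FSM I O} {T : ObsTree I O} (hT : T.Valid M)
    {q r r' σ : List I} (h : T.Witness r r' σ) (hq : T (q ++ σ) ≠ none) :
    T.Apart q r ∨ T.Apart q r' := by
  obtain ⟨hr, hr', hne⟩ := hT.witness_iff.1 h
  by_contra! hcon
  exact hne ((hT.resp_eq hcon.1 hq hr).symm.trans (hT.resp_eq hcon.2 hq hr'))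

/-- `T'` contains all observations of `T`. -/
def Le (T T' : ObsTree I O) : Prop := ∀ w o, T w = some o → T' w = some o

theorem Le.refl (T : ObsTree I O) : T.Le T := fun _ _ h => h

theorem Le.ne_none {T T' : ObsTree I O} (h : T.Le T') {w : List I} (hw : T w ≠ none) :
    T' w ≠ none := by
  obtain ⟨o, ho⟩ := Option.ne_none_iff_exists'.1 hw
  simp [h w o ho]

theorem Le.apart {T T' : ObsTree I O} (h : T.Le T') {p q : List I} (hpq : T.Apart p q) :
    T'.Apart p q := by
  obtain ⟨σ, a, b, ha, hb, hab⟩ := hpq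
  exact ⟨σ, a, b, h _ _ ha, h _ _ hb, hab⟩

theorem Le.witness {T T' : ObsTree I O} (h : T.Le T') {p q σ : List I} (hpq : T.Witness p q σ) :
    T'.Witness p q σ := by
  obtain ⟨a, b, ha, hb, hab⟩ := hpq
  exact ⟨a, b, h _ _ ha, h _ _ hb, hab⟩

theorem Valid.le_observe {M : FSM I O} {T : ObsTree I O} (hT : T.Valid M) (w : List I) :
    T.Le (T.observe w (M.output w)) := by
  intro x o hx
  unfold ObsTree.observe
  split_ifs with h
  · rw [M.take_output h, hT.sound x o hx]
  · exact hx

theorem observe_self_ne_none {M : FSM I O} {T : ObsTree I O} {w : List I} :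
    T.observe w (M.output w) w ≠ none :=
  observe_ne_none.2 (.inl (List.prefix_refl w))

end ObsTree

/-! ### Hypotheses and the basis they are built on -/

namespace Hyp

theorem reach_mem (H : Hyp I O) (w : List I) : H.reach w ∈ H.basis :=
  (H.toFSM.nextStar H.toFSM.q0 w : {q // q ∈ H.basis}).2

theorem reach_concat (H : Hyp I O) (w : List I) (i : I) :
    H.reach (w ++ [i]) = (H.next ⟨H.reach w, H.reach_mem w⟩ i).1 := by
  unfold reach
  rw [FSM.nextStar_append]
  rfl

theorem reach_append_congr (H : Hyp I O) {u w : List I} (h : H.reach u = H.reach w)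
    (v : List I) : H.reach (u ++ v) = H.reach (w ++ v) := by
  unfold reach at *
  rw [FSM.nextStar_append, FSM.nextStar_append]
  exact congrArg (fun q => (H.toFSM.nextStar q v : {q // q ∈ H.basis}).1) (Subtype.ext h)

theorem resp_singleton (H : Hyp I O) (w : List I) (i : I) :
    H.toFSM.resp w [i] = [H.out ⟨H.reach w, H.reach_mem w⟩ i] := rfl

/-- `H` keeps the transitions of `T` between basis states, the basis is complete, and every other
transition leads to the only basis state from which its target may be not apart. -/
structure Fits (H : Hyp I O) (S : Finset (List I)) (T : ObsTree I O) : Prop where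
  basis_eq : H.basis = S
  complete : ∀ q ∈ S, ∀ i : I, T (q ++ [i]) ≠ none
  keep : ∀ (q : {q // q ∈ H.basis}) (i : I), q.1 ++ [i] ∈ S → (H.next q i).1 = q.1 ++ [i]
  redirect : ∀ (q : {q // q ∈ H.basis}) (i : I), q.1 ++ [i] ∉ S →
    ∀ p ∈ S, p ≠ (H.next q i).1 → T.Apart (q.1 ++ [i]) p

/-- Apartness only grows with the tree. `IsFor` need not persist: its redirections must be not apart
from their sources, and a search refutes just this. `Fits` is the part that survives the search. -/
theorem Fits.mono {H : Hyp I O} {S : Finset (List I)} {T T' : ObsTree I O} (h : H.Fits S T)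
    (hT : T.Le T') : H.Fits S T' where
  basis_eq := h.basis_eq
  complete q hq i := hT.ne_none (h.complete q hq i)
  keep := h.keep
  redirect q i hq p hp hne := hT.apart (h.redirect q i hq p hp hne)

theorem Fits.reach_mem {H : Hyp I O} {S : Finset (List I)} {T : ObsTree I O} (h : H.Fits S T)
    (w : List I) : H.reach w ∈ S :=
  h.basis_eq ▸ H.reach_mem w

/-- As the basis is prefix-closed, the path to a basis state stays inside it, where all transitions
are kept. -/
theorem Fits.reach_of_mem {H : Hyp I O} {S : Finset (List I)} {T : ObsTree I O} (h : H.Fits S T)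
    (hS : ∀ p i, p ++ [i] ∈ S → p ∈ S) (p : List I) (hp : p ∈ S) : H.reach p = p := by
  induction p using List.reverseRecOn with
  | nil => rfl
  | append_singleton p i ih =>
    have hr := ih (hS p i hp)
    rw [reach_concat, h.keep _ _ (by simpa [hr] using hp)]
    simp [hr]

/-- A transition of `H` into a state that is apart from its redirection shows that this state is
apart from the whole basis. -/
theorem Fits.apart_of_apart_reach {H : Hyp I O} {S : Finset (List I)} {T : ObsTree I O}
    (h : H.Fits S T) (hS : ∀ p i, p ++ [i] ∈ S → p ∈ S) {q : List I} {i : I} (hq : q ∈ S)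
    (hqi : q ++ [i] ∉ S) (hc : T.Apart (H.reach (q ++ [i])) (q ++ [i])) :
    ∀ p ∈ S, T.Apart (q ++ [i]) p := by
  intro p hp
  have hr := h.reach_of_mem hS q hq
  by_cases hpe : p = H.reach (q ++ [i])
  · exact hpe ▸ hc.symm
  · have := h.redirect ⟨H.reach q, H.reach_mem q⟩ i (by simpa [hr] using hqi) p hp
      (by rwa [← reach_concat])
    simpa [hr] using this

end Hyp

/-! ### Distance from the basis -/

/-- The length of `σ` beyond its longest prefix in `S`. -/
noncomputable def overhang (S : Finset (List I)) (σ : List I) : ℕ :=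
  sInf {m | ∃ p ∈ S, p <+: σ ∧ σ.length = p.length + m}

theorem overhang_le {S : Finset (List I)} {σ p : List I} (hp : p ∈ S) (h : p <+: σ) :
    overhang S σ ≤ σ.length - p.length :=
  Nat.sInf_le ⟨p, hp, h, by have := h.length_le; omega⟩

theorem prefix_mem {S : Finset (List I)} (hS : ∀ p i, p ++ [i] ∈ S → p ∈ S) {p v : List I}
    (h : p ++ v ∈ S) : p ∈ S := by
  induction v using List.reverseRecOn with
  | nil => simpa using h
  | append_singleton v i ih => exact ih (hS _ i (by simpa using h))

/-- A prefix-closed set cannot be re-entered once it has been left, so `q` is the longest prefix of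
`σ` in `S`. -/
theorem overhang_eq {S : Finset (List I)} (hS : ∀ p i, p ++ [i] ∈ S → p ∈ S) {q σ : List I}
    {i : I} (hq : q ∈ S) (hqi : q ++ [i] ∉ S) (h : q ++ [i] <+: σ) :
    overhang S σ = σ.length - q.length := by
  refine le_antisymm (overhang_le hq ((List.prefix_append _ _).trans h)) ?_
  have hl := h.length_le
  refine le_csInf ⟨_, q, hq, (List.prefix_append _ _).trans h, (by simp at hl; omega :
    σ.length = q.length + (σ.length - q.length))⟩ ?_
  rintro m ⟨p, hp, hpσ, hm⟩
  by_contra hlt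
  have hlen : (q ++ [i]).length ≤ p.length := by simp; omega
  obtain ⟨v, rfl⟩ := List.prefix_of_prefix_length_le h hpσ hlen
  exact hqi (prefix_mem hS hp)

/-- A sequence outside `S` leaves `S` at some prefix. -/
theorem exists_exit {S : Finset (List I)} (h0 : [] ∈ S) {σ : List I} (hσ : σ ∉ S) :
    ∃ q ∈ S, ∃ i, q ++ [i] ∉ S ∧ q ++ [i] <+: σ := by
  induction σ using List.reverseRecOn with
  | nil => exact absurd h0 hσ
  | append_singleton σ i ih =>
    by_cases h : σ ∈ S
    · exact ⟨σ, h, i, hσ, List.prefix_refl _⟩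
    · obtain ⟨q, hq, j, hj, hp⟩ := ih h
      exact ⟨q, hq, j, hj, hp.trans (List.prefix_append _ _)⟩

/-- The prefixes of `p`, including `[]` and `p`, are `p.length + 1` different members of `S`. -/
theorem length_lt_card {S : Finset (List I)} (hS : ∀ p i, p ++ [i] ∈ S → p ∈ S) {p : List I}
    (hp : p ∈ S) : p.length < S.card := by
  classical
  have hsub : (Finset.range (p.length + 1)).image (fun n => p.take n) ⊆ S := by
    intro w hw
    obtain ⟨n, -, rfl⟩ := Finset.mem_image.1 hw
    exact prefix_mem hS (v := p.drop n) (by simpa using hp)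
  have := Finset.card_le_card hsub
  rw [Finset.card_image_of_injOn, Finset.card_range] at this
  · exact this
  · intro a ha b hb hab
    have := congrArg List.length hab
    simp at this ha hb
    omega

/-! ### The invariant of `L#` and the binary search -/

namespace LConfig

/-- Some frontier state is apart from all basis states. -/
def Isolated (c : LConfig I O) : Prop := ∃ q, c.Frontier q ∧ ∀ p ∈ c.basis, c.tree.Apart q p

/-- What holds in the modes of `L#`. -/
def ModeInv (M : FSM I O) (c : LConfig I O) : LMode I O → Prop
  | .explore => True
  | .search H σ => H.Fits c.basis c.tree ∧ c.Conflict H σ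
  | .done H => H.basis = c.basis ∧ H.toFSM.Equivalent M

/-- The invariant of `L#` for the machine `M`. -/
structure Inv (M : FSM I O) (c : LConfig I O) : Prop where
  valid : c.tree.Valid M
  nil_mem : [] ∈ c.basis
  closed : ∀ p i, p ++ [i] ∈ c.basis → p ∈ c.basis
  observed : ∀ p ∈ c.basis, c.tree p ≠ none
  apart : ∀ p ∈ c.basis, ∀ q ∈ c.basis, p ≠ q → c.tree.Apart p q
  mode : ModeInv M c c.mode

theorem inv_init (M : FSM I O) (L : List (List I)) : Inv M (init M L) where
  valid := ObsTree.valid_ofLog M L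
  nil_mem := by simp [init]
  closed := by simp [init]
  observed := by simpa [init] using (ObsTree.valid_ofLog M L).root
  apart := by simp [init]
  mode := trivial

theorem Frontier.mono {c c' : LConfig I O} {w : List I} (h : c.Frontier w)
    (hb : c'.basis = c.basis) (ht : c.tree.Le c'.tree) : c'.Frontier w := by
  obtain ⟨h1, h2, h3⟩ := h
  exact ⟨hb ▸ h1, ht.ne_none h2, hb ▸ h3⟩

theorem Isolated.mono {c c' : LConfig I O} (h : c.Isolated)
    (hb : c'.basis = c.basis) (ht : c.tree.Le c'.tree) : c'.Isolated := by
  obtain ⟨q, hq, h⟩ := h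
  exact ⟨q, hq.mono hb ht, fun p hp => ht.apart (h p (hb ▸ hp))⟩

theorem Inv.query {M : FSM I O} {c : LConfig I O} (hc : c.Inv M) (w : List I)
    (hm : c.mode = .explore) : (c.query M w).Inv M where
  valid := hc.valid.observe w
  nil_mem := hc.nil_mem
  closed := hc.closed
  observed p hp := (hc.valid.le_observe w).ne_none (hc.observed p hp)
  apart p hp q hq h := (hc.valid.le_observe w).apart (hc.apart p hp q hq h)
  mode := by
    change ModeInv M _ c.mode
    rw [hm]
    trivial

theorem Settled.not_isolated {c : LConfig I O} (h : c.Settled) : ¬ c.Isolated := by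
  rintro ⟨q, hq, hiso⟩
  obtain ⟨p, ⟨hp, hnot⟩, -⟩ := h.2 q hq
  exact hnot (hiso p hp)

/-- The redirection is not apart from the frontier state, and by `Settled` only one basis state has
this property, so all others are apart. -/
theorem Builds.fits {c : LConfig I O} {H : Hyp I O} (h : c.Builds H) :
    H.Fits c.basis c.tree := by
  obtain ⟨-, ⟨hcomp, huniq⟩, hb, hH⟩ := h
  refine ⟨hb, hcomp, fun q i hqi => (hH q i).2.1 hqi, fun q i hqi p hp hne => ?_⟩
  have hq : q.1 ∈ c.basis := hb ▸ q.2
  obtain ⟨r, -, hr⟩ := huniq (q.1 ++ [i]) ⟨hqi, hcomp q.1 hq i, q.1, hq, i, rfl⟩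
  by_contra hnot
  have h1 := hr p ⟨hp, hnot⟩
  have h2 := hr (H.next q i).1 ⟨hb ▸ (H.next q i).2, (hH q i).2.2 hqi⟩
  exact hne (h1.trans h2.symm)

theorem Inv.conflict_notMem {M : FSM I O} {c : LConfig I O} (hc : c.Inv M) {H : Hyp I O}
    {σ : List I} (hH : H.Fits c.basis c.tree) (hσ : c.Conflict H σ) : σ ∉ c.basis := by
  intro h
  have := hσ.2
  rw [hH.reach_of_mem hc.closed σ h] at this
  exact hc.valid.not_apart_self σ this

/-- In a search, the state at which the search ends is isolated. -/
theorem Inv.isolated {M : FSM I O} {c : LConfig I O} (hc : c.Inv M) {H : Hyp I O} {σ : List I}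
    (hH : H.Fits c.basis c.tree) (hσ : c.Conflict H σ) (h : σ ∈ c.basis ∨ c.Frontier σ) :
    c.Isolated := by
  rcases h with h | h
  · exact absurd h (hc.conflict_notMem hH hσ)
  · obtain ⟨h1, h2, q, hq, i, rfl⟩ := h
    exact ⟨_, ⟨h1, h2, q, hq, i, rfl⟩, hH.apart_of_apart_reach hc.closed hq h1 hσ.2⟩

theorem Inv.exists_frontier {M : FSM I O} {c : LConfig I O} (hc : c.Inv M) {σ : List I}
    (hσ : c.tree σ ≠ none) (h : σ ∉ c.basis) : ∃ ρ, c.Frontier ρ ∧ ρ <+: σ := by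
  obtain ⟨q, hq, i, hqi, v, rfl⟩ := exists_exit hc.nil_mem h
  exact ⟨q ++ [i], ⟨hqi, hc.valid.closed _ _ hσ, q, hq, i, rfl⟩, List.prefix_append _ _⟩

open Classical in
/-- One round of binary search keeps the conflict and halves the distance to the frontier. -/
theorem Inv.split {M : FSM I O} {c c' : LConfig I O} (hc : c.Inv M) {H : Hyp I O}
    {σ ρ η σ' : List I} (hH : H.Fits c.basis c.tree) (hσ : c.Conflict H σ)
    (hn : ¬ (σ ∈ c.basis ∨ c.Frontier σ)) (hρ : c.Frontier ρ) (hρσ : ρ <+: σ)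
    (hη : c.tree.Witness (H.reach σ) σ η)
    (hc' : c' = c.query M (H.reach (σ.take ((ρ.length + σ.length) / 2)) ++
      σ.drop ((ρ.length + σ.length) / 2) ++ η))
    (hσ' : σ' = if c'.tree.Apart (H.reach (σ.take ((ρ.length + σ.length) / 2)))
        (σ.take ((ρ.length + σ.length) / 2)) then σ.take ((ρ.length + σ.length) / 2)
      else H.reach (σ.take ((ρ.length + σ.length) / 2)) ++
        σ.drop ((ρ.length + σ.length) / 2)) :
    c'.Conflict H σ' ∧ 2 ≤ overhang c.basis σ ∧
      overhang c.basis σ' - 1 ≤ (overhang c.basis σ - 1) / 2 := by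
  set h := (ρ.length + σ.length) / 2 with hh
  have hlen := hρσ.length_le
  obtain ⟨hρS, hρT, q, hq, i, rfl⟩ := hρ
  have hlq : (q ++ [i]).length = q.length + 1 := by simp
  have hne : (q ++ [i]).length ≠ σ.length := by
    intro heq
    have := hρσ.eq_of_length heq
    subst this
    exact hn (.inr ⟨hρS, hρT, q, hq, i, rfl⟩)
  have hov := overhang_eq hc.closed hq hρS hρσ
  have hv : c'.tree.Valid M := by
    rw [hc']; exact hc.valid.observe _
  have hle : c.tree.Le c'.tree := by
    rw [hc']; exact hc.valid.le_observe _
  have htd : σ.take h ++ σ.drop h = σ := List.take_append_drop h σ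
  have hobs : c'.tree (H.reach (σ.take h) ++ σ.drop h ++ η) ≠ none := by
    rw [hc']; exact ObsTree.observe_self_ne_none
  refine ⟨?_, by omega, ?_⟩
  · rw [hσ']
    split_ifs with hap
    · refine ⟨hle.ne_none (hc.valid.closed _ (σ.drop h) ?_), hap⟩
      rw [htd]; exact hσ.1
    · refine ⟨hv.closed _ _ hobs, ?_⟩
      have hreach : H.reach (H.reach (σ.take h) ++ σ.drop h) = H.reach σ := by
        conv_rhs => rw [← htd]
        exact H.reach_append_congr (hH.reach_of_mem hc.closed _ (hH.reach_mem _)) _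
      rw [hreach, hv.apart_iff]
      obtain ⟨h1, h2, h3⟩ := hv.witness_iff.1 (hle.witness hη)
      refine ⟨η, h1, hobs, fun heq => h3 ?_⟩
      -- The tree states `H.reach (σ.take h)` and `σ.take h` are not apart, so they answer `σ.drop h
      -- ++ η` alike. Thus `η` gets the same answer at the new sequence as at `σ`, and this differs
      -- from the answer at `H.reach σ`.
      have hr := hv.resp_eq (σ := σ.drop h ++ η) hap (by simpa using hobs)
        (by rw [← List.append_assoc, htd]; exact h2)
      rw [M.resp_append, M.resp_append, htd] at hr
      rw [heq]
      exact (List.append_inj hr (by simp [M.length_resp])).2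
  -- With `a = |σ| - |ρ|`, the prefix branch leaves `⌊a/2⌋` letters beyond the frontier. The other
  -- branch puts `⌈a/2⌉` letters after a basis state, hence at most `⌈a/2⌉ - 1` beyond the frontier.
  · rw [hσ']
    split_ifs with hap
    · have hpre : q <+: σ.take h := by
        rw [List.prefix_take_iff]
        exact ⟨(List.prefix_append _ _).trans hρσ, by omega⟩
      have := overhang_le hq hpre
      rw [List.length_take] at this
      omega
    · have := overhang_le (hH.reach_mem (σ.take h))
        (List.prefix_append (H.reach (σ.take h)) (σ.drop h))
      rw [List.length_append, List.length_drop] at this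
      omega

end LConfig

/-! ### Monotonicity and preservation of the invariant -/

open LConfig

theorem LStep.basis_subset {M : FSM I O} {c c' : LConfig I O} (h : LStep M c c') :
    c.basis ⊆ c'.basis := by
  classical
  cases h <;> first | exact Finset.subset_insert _ _ | exact Finset.Subset.refl _ | skip
  subst_vars
  exact Finset.Subset.refl _

theorem LStep.tree_le {M : FSM I O} {c c' : LConfig I O} (h : LStep M c c')
    (hc : c.Inv M) : c.tree.Le c'.tree := by
  cases h <;> first | exact ObsTree.Le.refl _ | exact hc.valid.le_observe _ | skip
  subst_vars
  exact hc.valid.le_observe _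

theorem LStep.inv {M : FSM I O} {c c' : LConfig I O} (h : LStep M c c') (hc : c.Inv M) :
    c'.Inv M := by
  classical
  cases h with
  | promote q hm hq hiso =>
    refine ⟨hc.valid, by simp [hc.nil_mem], ?_, ?_, ?_, ?_⟩
    · intro p i hp
      rcases Finset.mem_insert.1 hp with hp | hp
      -- A frontier state extends a basis state by one letter, so the basis stays prefix-closed.
      · obtain ⟨-, -, r, hr, j, rfl⟩ := hq
        obtain ⟨rfl, -⟩ := List.append_inj' hp rfl
        exact Finset.mem_insert_of_mem hr
      · exact Finset.mem_insert_of_mem (hc.closed p i hp)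
    · intro p hp
      rcases Finset.mem_insert.1 hp with rfl | hp
      · exact hq.2.1
      · exact hc.observed p hp
    · intro p hp r hr hne
      rcases Finset.mem_insert.1 hp with rfl | hp' <;>
        rcases Finset.mem_insert.1 hr with rfl | hr'
      · exact absurd rfl hne
      · exact hiso r hr'
      · exact (hiso p hp').symm
      · exact hc.apart p hp' r hr' hne
    · change ModeInv M _ c.mode
      rw [hm]; trivial
  | extend q i hm hq hn => exact hc.query _ hm
  | identify q r r' σ hm hq hr hr' hne h1 h2 hw => exact hc.query _ hm
  | inconsistent H σ hb hσ =>
    exact ⟨hc.valid, hc.nil_mem, hc.closed, hc.observed, hc.apart, hb.fits, hσ⟩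
  | accept H hb hcon heq =>
    exact ⟨hc.valid, hc.nil_mem, hc.closed, hc.observed, hc.apart, hb.2.2.1, heq⟩
  | refute H ρ σ hb hcon hne hpre hσ hmin =>
    have := hc.query ρ hb.1
    exact ⟨this.valid, this.nil_mem, this.closed, this.observed, this.apart,
      hb.fits.mono (hc.valid.le_observe ρ), hσ⟩
  | finish H σ hm hσ =>
    exact ⟨hc.valid, hc.nil_mem, hc.closed, hc.observed, hc.apart, trivial⟩
  | split H σ ρ σ₁ σ₂ η σ' d hm hn hρ hρσ h1 h2 hη hd hσ' =>
    have hmode := hc.mode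
    rw [hm] at hmode
    subst h1 h2
    have hs := hc.split hmode.1 hmode.2 hn hρ hρσ hη hd hσ'
    have hle : c.tree.Le d.tree := by subst hd; exact hc.valid.le_observe _
    have hbd : d.basis = c.basis := by subst hd; rfl
    have hvd : d.tree.Valid M := by subst hd; exact hc.valid.observe _
    refine ⟨hvd, ?_, ?_, ?_, ?_, ?_, hs.1⟩
    · exact hbd ▸ hc.nil_mem
    · exact hbd ▸ hc.closed
    · exact fun p hp => hle.ne_none (hc.observed p (hbd ▸ hp))
    · exact fun p hp q hq h => hle.apart (hc.apart p (hbd ▸ hp) q (hbd ▸ hq) h)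
    · change H.Fits d.basis d.tree
      rw [hbd]
      exact hmode.1.mono hle

/-- The size bound `n` speaks of the models and not of the implementations, hence the second machine
`N`, which shares all responses with `M`. -/
theorem LConfig.Inv.card_le {M N : FSM I O} {c : LConfig I O} (hc : c.Inv M)
    (h : N.Equivalent M) : c.basis.card ≤ N.size := by
  refine N.card_le_size _ fun p hp q hq hne => ?_
  obtain ⟨σ, -, -, hσ⟩ := hc.valid.apart_iff.1 (hc.apart p hp q hq hne)
  exact ⟨σ, by rwa [h.resp_eq, h.resp_eq]⟩

/-! ### Progress -/

/-- A hypothesis that disagrees with an observed sequence is in conflict with the tree. -/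
theorem LConfig.exists_conflict {M : FSM I O} {c d : LConfig I O} {H : Hyp I O}
    (hc : c.Inv M) (hb : c.Builds H) (hd : d.tree.Valid M) (hle : c.tree.Le d.tree)
    {ρ : List I} (hρ : d.tree ρ ≠ none) (hne : H.toFSM.output ρ ≠ M.output ρ) :
    ∃ σ, σ <+: ρ ∧ d.Conflict H σ := by
  by_contra! hcon
  -- Without a conflict, `H.reach w` and `w` are not apart, so they answer the next input alike; the
  -- answer at the basis state is the output that `H` took from the tree.
  have key : ∀ w, w <+: ρ → H.toFSM.output w = M.output w := by
    intro w
    induction w using List.reverseRecOn with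
    | nil => intro _; rfl
    | append_singleton w i ih =>
      intro hw
      have hwρ := (List.prefix_append w [i]).trans hw
      rw [FSM.output_append, FSM.output_append, ih hwρ]
      congr 1
      obtain ⟨v, hv⟩ := hw
      have hwi : d.tree (w ++ [i]) ≠ none := hd.closed _ v (hv ▸ hρ)
      have hnot : ¬ d.tree.Apart (H.reach w) w := fun h =>
        hcon w hwρ ⟨hd.closed _ [i] hwi, h⟩
      obtain ⟨o, ho⟩ := (hb.2.2.2 ⟨H.reach w, H.reach_mem w⟩ i).1
      have hr := hd.resp_eq (σ := [i]) hnot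
        (hle.ne_none (by rw [ho]; simp)) hwi
      rw [← hr, H.resp_singleton]
      have := hc.valid.sound _ _ ho
      rw [M.output_append] at this
      exact (List.append_inj' this (by simp [M.length_resp])).2
  exact hne (key ρ (List.prefix_refl ρ))

theorem LConfig.exists_builds {M : FSM I O} {c : LConfig I O} (hc : c.Inv M)
    (hm : c.mode = .explore) (hs : c.Settled) : ∃ H, c.Builds H := by
  have hout : ∀ (q : {q // q ∈ c.basis}) (i : I), ∃ a o, c.tree (q.1 ++ [i]) = some (o ++ [a]) := by
    intro q i
    refine ⟨M.out (M.nextStar M.q0 q.1) i, M.output q.1, ?_⟩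
    rw [hc.valid.eq_some (hs.1 q.1 q.2 i), M.output_append]
    rfl
  have hnext : ∀ (q : {q // q ∈ c.basis}) (i : I), ∃ r : {q // q ∈ c.basis},
      (q.1 ++ [i] ∈ c.basis → r.1 = q.1 ++ [i]) ∧
      (q.1 ++ [i] ∉ c.basis → ¬ c.tree.Apart (q.1 ++ [i]) r.1) := by
    intro q i
    by_cases h : q.1 ++ [i] ∈ c.basis
    · exact ⟨⟨_, h⟩, fun _ => rfl, fun h' => absurd h h'⟩
    · obtain ⟨p, ⟨hp, hnot⟩, -⟩ := hs.2 (q.1 ++ [i]) ⟨h, hs.1 q.1 q.2 i, q.1, q.2, i, rfl⟩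
      exact ⟨⟨p, hp⟩, fun h' => absurd h' h, fun _ => hnot⟩
  choose out hout using hout
  choose next hnext using hnext
  exact ⟨⟨c.basis, hc.nil_mem, next, out⟩, hm, hs, rfl, fun q i => ⟨hout q i, hnext q i⟩⟩

/-- `L#` stops only in the mode `done`. -/
theorem LConfig.Inv.exists_step {M : FSM I O} {c : LConfig I O} (hc : c.Inv M)
    (hd : ∀ H, c.mode ≠ .done H) : ∃ c', LStep M c c' := by
  classical
  have hmode := hc.mode
  match hm : c.mode with
  | .done H => exact absurd hm (hd H)
  | .search H σ =>
    rw [hm] at hmode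
    obtain ⟨-, hσ⟩ := hmode
    by_cases hn : σ ∈ c.basis ∨ c.Frontier σ
    · exact ⟨_, .finish c H σ hm hn⟩
    · obtain ⟨ρ, hρ, hρσ⟩ := hc.exists_frontier hσ.1 fun h => hn (.inl h)
      obtain ⟨η, hη⟩ := hσ.2
      exact ⟨_, .split c H σ ρ _ _ η _ _ hm hn hρ hρσ rfl rfl hη rfl rfl⟩
  | .explore =>
    by_cases hcomp : ∀ q ∈ c.basis, ∀ i : I, c.tree (q ++ [i]) ≠ none
    swap
    · push Not at hcomp
      obtain ⟨q, hq, i, hi⟩ := hcomp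
      exact ⟨_, .extend c q i hm hq hi⟩
    by_cases hiso : c.Isolated
    · obtain ⟨q, hq, h⟩ := hiso
      exact ⟨_, .promote c q hm hq h⟩
    by_cases hs : c.Settled
    swap
    · have : ∃ q, c.Frontier q ∧ ¬ ∃! p, p ∈ c.basis ∧ ¬ c.tree.Apart q p := by
        by_contra! h
        exact hs ⟨hcomp, h⟩
      obtain ⟨q, hq, hnu⟩ := this
      have hex : ∃ r ∈ c.basis, ¬ c.tree.Apart q r := by
        by_contra! h
        exact hiso ⟨q, hq, h⟩
      obtain ⟨r, hr, hqr⟩ := hex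
      have hex' : ∃ r' ∈ c.basis, ¬ c.tree.Apart q r' ∧ r' ≠ r := by
        by_contra! h
        exact hnu ⟨r, ⟨hr, hqr⟩, fun y hy => h y hy.1 hy.2⟩
      obtain ⟨r', hr', hqr', hne⟩ := hex'
      obtain ⟨σ, hσ⟩ := hc.apart r hr r' hr' hne.symm
      exact ⟨_, .identify c q r r' σ hm hq hr hr' hne.symm hqr hqr' hσ⟩
    obtain ⟨H, hH⟩ := exists_builds hc hm hs
    by_cases hcon : ∃ σ, c.Conflict H σ
    · obtain ⟨σ, hσ⟩ := hcon
      exact ⟨_, .inconsistent c H σ hH hσ⟩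
    push Not at hcon
    by_cases heq : H.toFSM.Equivalent M
    · exact ⟨_, .accept c H hH hcon heq⟩
    unfold FSM.Equivalent at heq
    push Not at heq
    obtain ⟨ρ, hρ⟩ := heq
    -- The rule `refute` asks for a shortest conflicting prefix; it is found by minimising the
    -- length.
    have hex : ∃ n, ∃ σ, σ.length = n ∧ σ <+: ρ ∧ (c.query M ρ).Conflict H σ := by
      obtain ⟨σ, h1, h2⟩ := exists_conflict (d := c.query M ρ) hc hH (hc.valid.observe ρ)
        (hc.valid.le_observe ρ) ObsTree.observe_self_ne_none hρ
      exact ⟨_, σ, rfl, h1, h2⟩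
    obtain ⟨σ, hl, h1, h2⟩ := Nat.find_spec hex
    exact ⟨_, .refute c H ρ σ hH hcon hρ h1 h2 fun τ hτ hlt hcf =>
      Nat.find_min hex (hl ▸ hlt) ⟨τ, rfl, hτ, hcf⟩⟩

/-! ### Counting -/

namespace LConfig

/-- The explored transitions of the basis. -/
def explored (c : LConfig I O) : Set (List I × I) :=
  {x | x.1 ∈ c.basis ∧ c.tree (x.1 ++ [x.2]) ≠ none}

/-- The transitions of the basis and basis states that are known to be apart. -/
def separated (c : LConfig I O) : Set ((List I × I) × List I) :=
  {x | (x.1.1 ∈ c.basis ∧ x.2 ∈ c.basis) ∧ c.tree.Apart (x.1.1 ++ [x.1.2]) x.2}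

/-- The numbers of explored transitions and of known apartnesses. -/
noncomputable def knowledge (c : LConfig I O) : ℕ := c.explored.ncard + c.separated.ncard

theorem explored_subset (c : LConfig I O) :
    c.explored ⊆ (c.basis : Set (List I)) ×ˢ (Set.univ : Set I) :=
  fun _ hx => ⟨hx.1, trivial⟩

theorem separated_subset (c : LConfig I O) :
    c.separated ⊆ ((c.basis : Set (List I)) ×ˢ (Set.univ : Set I)) ×ˢ (c.basis : Set (List I)) :=
  fun _ hx => ⟨⟨hx.1.1, trivial⟩, hx.1.2⟩

variable [Finite I]

theorem finite_explored (c : LConfig I O) : c.explored.Finite :=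
  (c.basis.finite_toSet.prod Set.finite_univ).subset c.explored_subset

theorem finite_separated (c : LConfig I O) : c.separated.Finite :=
  ((c.basis.finite_toSet.prod Set.finite_univ).prod c.basis.finite_toSet).subset
    c.separated_subset

theorem knowledge_le (c : LConfig I O) :
    c.knowledge ≤ c.basis.card * Nat.card I + c.basis.card * Nat.card I * c.basis.card := by
  refine Nat.add_le_add ?_ ?_
  · refine (Set.ncard_le_ncard c.explored_subset
      (c.basis.finite_toSet.prod Set.finite_univ)).trans ?_
    rw [Set.ncard_prod, Set.ncard_coe_finset, Set.ncard_univ]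
  · refine (Set.ncard_le_ncard c.separated_subset
      ((c.basis.finite_toSet.prod Set.finite_univ).prod c.basis.finite_toSet)).trans ?_
    rw [Set.ncard_prod, Set.ncard_prod, Set.ncard_coe_finset, Set.ncard_univ]

/-- `separated` is indexed by all transitions of the basis, not just those into the frontier, so
promoting a frontier state loses nothing. -/
theorem knowledge_mono {c c' : LConfig I O} (hb : c.basis ⊆ c'.basis) (ht : c.tree.Le c'.tree) :
    c.knowledge ≤ c'.knowledge :=
  Nat.add_le_add
    (Set.ncard_le_ncard (fun _ hx => ⟨hb hx.1, ht.ne_none hx.2⟩) c'.finite_explored)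
    (Set.ncard_le_ncard (fun _ hx => ⟨⟨hb hx.1.1, hb hx.1.2⟩, ht.apart hx.2⟩) c'.finite_separated)

theorem knowledge_lt_of_explored {c c' : LConfig I O} (hb : c.basis ⊆ c'.basis)
    (ht : c.tree.Le c'.tree) {q : List I} {i : I} (hq : q ∈ c.basis)
    (hn : c.tree (q ++ [i]) = none) (hs : c'.tree (q ++ [i]) ≠ none) :
    c.knowledge < c'.knowledge := by
  refine Nat.add_lt_add_of_lt_of_le (Set.ncard_lt_ncard ⟨?_, ?_⟩ c'.finite_explored)
    (Set.ncard_le_ncard ?_ c'.finite_separated)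
  · exact fun _ hx => ⟨hb hx.1, ht.ne_none hx.2⟩
  · intro h
    exact (h (show (q, i) ∈ c'.explored from ⟨hb hq, hs⟩)).2 hn
  · exact fun _ hx => ⟨⟨hb hx.1.1, hb hx.1.2⟩, ht.apart hx.2⟩

theorem knowledge_lt_of_separated {c c' : LConfig I O} (hb : c.basis ⊆ c'.basis)
    (ht : c.tree.Le c'.tree) {q r : List I} (hq : c.Frontier q) (hr : r ∈ c.basis)
    (hn : ¬ c.tree.Apart q r) (hs : c'.tree.Apart q r) :
    c.knowledge < c'.knowledge := by
  obtain ⟨-, -, p, hp, i, rfl⟩ := hq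
  refine Nat.add_lt_add_of_le_of_lt (Set.ncard_le_ncard ?_ c'.finite_explored)
    (Set.ncard_lt_ncard ⟨?_, ?_⟩ c'.finite_separated)
  · exact fun _ hx => ⟨hb hx.1, ht.ne_none hx.2⟩
  · exact fun _ hx => ⟨⟨hb hx.1.1, hb hx.1.2⟩, ht.apart hx.2⟩
  · intro h
    exact hn (h (show ((p, i), r) ∈ c'.separated from ⟨⟨hb hp, hb hr⟩, hs⟩)).2

theorem Inv.knowledge_lt_extend {M : FSM I O} {c : LConfig I O} (hc : c.Inv M) {q : List I}
    {i : I} (hq : q ∈ c.basis) (hn : c.tree (q ++ [i]) = none) :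
    c.knowledge < (c.query M (q ++ [i])).knowledge :=
  knowledge_lt_of_explored (Finset.Subset.refl _) (hc.valid.le_observe _) hq hn
    ObsTree.observe_self_ne_none

theorem Inv.knowledge_lt_identify {M : FSM I O} {c : LConfig I O} (hc : c.Inv M)
    {q r r' σ : List I} (hq : c.Frontier q) (hr : r ∈ c.basis) (hr' : r' ∈ c.basis)
    (h1 : ¬ c.tree.Apart q r) (h2 : ¬ c.tree.Apart q r') (hw : c.tree.Witness r r' σ) :
    c.knowledge < (c.query M (q ++ σ)).knowledge := by
  have hle := hc.valid.le_observe (q ++ σ)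
  rcases (hc.valid.observe (q ++ σ)).apart_or_apart (hle.witness hw)
    ObsTree.observe_self_ne_none with h | h
  · exact knowledge_lt_of_separated (Finset.Subset.refl _) hle hq hr h1 h
  · exact knowledge_lt_of_separated (Finset.Subset.refl _) hle hq hr' h2 h

/-! ### Termination of `L#` -/

open Classical in
/-- The stage of `L#` while its knowledge does not grow. -/
noncomputable def stage (c : LConfig I O) : ℕ × ℕ :=
  match c.mode with
  | .explore => if c.Isolated then (1, 0) else (3, 0)
  | .search _ σ => (2, overhang c.basis σ)
  | .done _ => (0, 0)

/-- A bound for the basis and the knowledge of `L#` for `M`. -/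
noncomputable def limit (M : FSM I O) : ℕ :=
  M.size + (M.size * Nat.card I + M.size * Nat.card I * M.size)

theorem Inv.le_limit {M : FSM I O} {c : LConfig I O} (hc : c.Inv M) :
    c.basis.card + c.knowledge ≤ limit (I := I) M := by
  have h := hc.card_le (N := M) fun _ => rfl
  refine Nat.add_le_add h (c.knowledge_le.trans ?_)
  gcongr

omit [Finite I] in
theorem stage_explore {c : LConfig I O} (hm : c.mode = .explore) (h : ¬ c.Isolated) :
    c.stage = (3, 0) := by
  simp [stage, hm, h]

/-- Promotions and exploring queries enlarge basis or knowledge. The other steps lower the stage: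
exploring without an isolated state, searching with shrinking overhang, exploring with an isolated
state. From the last one only enlarging steps are possible, since a hypothesis requires `Settled`.
-/
theorem Inv.step_lt {M : FSM I O} {c c' : LConfig I O} (hc : c.Inv M) (h : LStep M c c') :
    c.basis.card + c.knowledge < c'.basis.card + c'.knowledge ∨
      c.basis.card + c.knowledge ≤ c'.basis.card + c'.knowledge ∧
        Prod.Lex (· < ·) (· < ·) c'.stage c.stage := by
  classical
  have hmono : c.basis.card + c.knowledge ≤ c'.basis.card + c'.knowledge :=
    Nat.add_le_add (Finset.card_le_card h.basis_subset)
      (knowledge_mono h.basis_subset (h.tree_le hc))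
  have hcard := Finset.card_le_card h.basis_subset
  have hknow := knowledge_mono h.basis_subset (h.tree_le hc)
  cases h with
  | promote q hm hq hiso =>
    left
    refine Nat.add_lt_add_of_lt_of_le ?_ hknow
    simp [Finset.card_insert_of_notMem hq.1]
  | extend q i hm hq hn =>
    exact .inl (Nat.add_lt_add_of_le_of_lt hcard (hc.knowledge_lt_extend hq hn))
  | identify q r r' σ hm hq hr hr' hne h1 h2 hw =>
    exact .inl (Nat.add_lt_add_of_le_of_lt hcard
      (hc.knowledge_lt_identify hq hr hr' h1 h2 hw))
  | inconsistent H σ hb hσ =>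
    refine .inr ⟨hmono, ?_⟩
    rw [stage_explore hb.1 hb.2.1.not_isolated]
    exact .left _ _ (by norm_num)
  | accept H hb hcon heq =>
    refine .inr ⟨hmono, ?_⟩
    rw [stage_explore hb.1 hb.2.1.not_isolated]
    exact .left _ _ (by norm_num)
  | refute H ρ σ hb hcon hne hpre hσ hmin =>
    refine .inr ⟨hmono, ?_⟩
    rw [stage_explore hb.1 hb.2.1.not_isolated]
    exact .left _ _ (by norm_num)
  | finish H σ hm hσ =>
    refine .inr ⟨hmono, ?_⟩
    have hmode := hc.mode
    rw [hm] at hmode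
    have hiso := hc.isolated hmode.1 hmode.2 hσ
    have hiso' : ({ c with mode := .explore } : LConfig I O).Isolated :=
      hiso.mono rfl (ObsTree.Le.refl _)
    have h1 : c.stage = (2, overhang c.basis σ) := by simp [stage, hm]
    rw [h1]
    simp only [stage, hiso', if_true]
    exact .left _ _ (by norm_num)
  | split H σ ρ σ₁ σ₂ η σ' d hm hn hρ hρσ h1 h2 hη hd hσ' =>
    refine .inr ⟨hmono, ?_⟩
    have hmode := hc.mode
    rw [hm] at hmode
    subst h1 h2
    have hs := hc.split hmode.1 hmode.2 hn hρ hρσ hη hd hσ'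
    have hbd : d.basis = c.basis := by subst hd; rfl
    have h1 : c.stage = (2, overhang c.basis σ) := by simp [stage, hm]
    rw [h1]
    simp only [stage]
    refine .right _ ?_
    rw [hbd]
    omega

theorem Inv.acc {M : FSM I O} {c : LConfig I O} (hc : c.Inv M) :
    Acc (fun c' c => LStep M c c') c := by
  have hwf : WellFounded (Prod.Lex (· < · : ℕ → ℕ → Prop)
      (Prod.Lex (· < · : ℕ → ℕ → Prop) (· < · : ℕ → ℕ → Prop))) :=
    WellFounded.prod_lex wellFounded_lt (WellFounded.prod_lex wellFounded_lt wellFounded_lt)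
  have key : ∀ x, ∀ c : LConfig I O, c.Inv M →
      (limit M - (c.basis.card + c.knowledge), c.stage) = x →
      Acc (fun c' c => LStep M c c') c := by
    intro x
    induction x using hwf.induction with
    | _ x ih =>
      rintro c hc rfl
      refine ⟨_, fun c' h => ih _ ?_ c' (h.inv hc) rfl⟩
      have hl := (h.inv hc).le_limit
      rcases hc.step_lt h with hlt | ⟨hle, hst⟩
      · exact .left _ _ (by omega)
      · rcases hle.eq_or_lt with heq | hlt
        · rw [heq]
          exact .right _ hst
        · exact .left _ _ (by omega)
  exact key _ c hc rfl

end LConfig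

/-! ### Costs of `L#` -/

namespace LConfig

/-- The bound for the number of remaining rounds of a binary search. -/
noncomputable def pending (c : LConfig I O) : ℕ :=
  match c.mode with
  | .search _ σ => (overhang c.basis σ - 1).size
  | _ => 0

theorem pending_of_explore {c : LConfig I O} (h : c.mode = .explore) : c.pending = 0 := by
  simp [pending, h]

/-- The number `J` of searches is bounded by the size of the basis. -/
def SearchBound (c : LConfig I O) (J : ℕ) : Prop :=
  match c.mode with
  | .explore => c.eq ≤ J ∧ J ≤ c.basis.card ∧ (J + 1 ≤ c.basis.card ∨ c.Isolated)
  | .search _ _ => c.eq ≤ J ∧ J ≤ c.basis.card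
  | .done _ => c.eq ≤ J + 1 ∧ J + 1 ≤ c.basis.card

/-- The queries posed by `L#` so far, after `J` searches. -/
structure Cost (c : LConfig I O) (J : ℕ) : Prop where
  search : c.SearchBound J
  queries : ∀ X, (∀ w, c.tree w ≠ none → w.length ≤ X) →
    c.oq + c.pending ≤ c.knowledge + J * (1 + X.size)

theorem cost_init (M : FSM I O) (L : List (List I)) : (init M L).Cost 0 where
  search := by simp [SearchBound, init]
  queries X hX := by simp [init, pending]

/-- Halving drops a binary digit; so each round of a search lowers `pending` by at least one. -/
theorem size_half_lt {x y : ℕ} (hx : 0 < x) (h : y ≤ x / 2) : y.size + 1 ≤ x.size := by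
  by_contra hlt
  have h1 : x.size - 1 < y.size ∨ y = 0 := by
    rcases Nat.eq_zero_or_pos y with h0 | h0
    · exact .inr h0
    · left
      have := Nat.size_pos.2 h0
      omega
  rcases h1 with h1 | rfl
  · have h2 := Nat.lt_size.1 h1
    have h3 := Nat.lt_size_self x
    have h4 := Nat.size_pos.2 hx
    have h5 : 2 ^ x.size = 2 ^ (x.size - 1) * 2 := by
      rw [← pow_succ]; congr 1; omega
    omega
  · have := Nat.size_pos.2 hx
    simp at hlt
    omega

theorem overhang_le_length {S : Finset (List I)} (h : [] ∈ S) (σ : List I) :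
    overhang S σ ≤ σ.length := by
  simpa using overhang_le h (List.nil_prefix (l := σ))

end LConfig

/-- Exploring queries are paid by the growth of `knowledge`. Opening a search raises `J` and prepays
it: `1` for the query of a counterexample, `X.size` for the rounds, of which `split` uses up one
each. A search ends with an isolated state and opens only without one, so a promotion lies between
any two searches. -/
theorem LStep.cost [Finite I] {M : FSM I O} {c c' : LConfig I O} (h : LStep M c c')
    (hc : c.Inv M) {J : ℕ} (hJ : c.Cost J) : ∃ J', c'.Cost J' := by
  classical
  obtain ⟨hs, hq⟩ := hJ
  have hle := h.tree_le hc
  have hknow := knowledge_mono h.basis_subset hle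
  -- A length bound for the new tree also holds for the old one, so `X` may stay quantified while
  -- the tree grows.
  have hmon : ∀ X, (∀ w, c'.tree w ≠ none → w.length ≤ X) →
      ∀ w, c.tree w ≠ none → w.length ≤ X := fun X hX w hw => hX w (hle.ne_none hw)
  cases h with
  | promote q hm hq' hiso =>
    simp only [SearchBound, pending, hm] at hs hq
    refine ⟨J, ?_, fun X hX => ?_⟩
    · simp only [SearchBound, hm, Finset.card_insert_of_notMem hq'.1]
      exact ⟨hs.1, by omega, .inl (by omega)⟩
    · have := hq X (hmon X hX)
      rw [pending_of_explore (c := { c with basis := insert q c.basis }) hm]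
      change c.oq + 0 ≤ _
      omega
  | extend q i hm hq' hn =>
    simp only [SearchBound, pending, hm] at hs hq
    refine ⟨J, ?_, fun X hX => ?_⟩
    · simp only [SearchBound, query, hm]
      exact ⟨hs.1, hs.2.1, hs.2.2.imp id fun h => h.mono rfl hle⟩
    · have := hq X (hmon X hX)
      have := hc.knowledge_lt_extend hq' hn
      rw [pending_of_explore (c := c.query M (q ++ [i])) hm]
      change c.oq + 1 + 0 ≤ _
      omega
  | identify q r r' σ hm hq' hr hr' hne h1 h2 hw =>
    simp only [SearchBound, pending, hm] at hs hq
    refine ⟨J, ?_, fun X hX => ?_⟩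
    · simp only [SearchBound, query, hm]
      exact ⟨hs.1, hs.2.1, hs.2.2.imp id fun h => h.mono rfl hle⟩
    · have := hq X (hmon X hX)
      have := hc.knowledge_lt_identify hq' hr hr' h1 h2 hw
      rw [pending_of_explore (c := c.query M (q ++ σ)) hm]
      change c.oq + 1 + 0 ≤ _
      omega
  | inconsistent H σ hb hσ =>
    simp only [SearchBound, pending, hb.1, hb.2.1.not_isolated, or_false] at hs hq
    refine ⟨J + 1, ⟨by simp only; omega, by simp only; omega⟩, fun X hX => ?_⟩
    have := hq X (hmon X hX)
    have hl : (overhang c.basis σ - 1).size ≤ X.size :=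
      Nat.size_le_size (by
        have := overhang_le_length hc.nil_mem σ
        have := hX σ hσ.1
        omega)
    simp only [pending]
    rw [Nat.add_mul]
    omega
  | accept H hb hcon heq =>
    simp only [SearchBound, pending, hb.1, hb.2.1.not_isolated, or_false] at hs hq
    refine ⟨J, ⟨by simp only; omega, by simp only; omega⟩, fun X hX => ?_⟩
    have := hq X (hmon X hX)
    simp only [pending]
    omega
  | refute H ρ σ hb hcon hne hpre hσ hmin =>
    simp only [SearchBound, pending, hb.1, hb.2.1.not_isolated, or_false] at hs hq
    refine ⟨J + 1, ⟨by simp only; omega, by simp only [query]; omega⟩, fun X hX => ?_⟩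
    have := hq X (hmon X hX)
    have hl : (overhang c.basis σ - 1).size ≤ X.size :=
      Nat.size_le_size (by
        have := overhang_le_length hc.nil_mem σ
        have := hX σ hσ.1
        omega)
    simp only [pending, query] at hknow ⊢
    rw [Nat.add_mul]
    omega
  | finish H σ hm hσ =>
    simp only [SearchBound, pending, hm] at hs hq
    have hmode := hc.mode
    rw [hm] at hmode
    have hiso := hc.isolated hmode.1 hmode.2 hσ
    refine ⟨J, ⟨hs.1, hs.2, .inr (hiso.mono rfl hle)⟩, fun X hX => ?_⟩
    have := hq X (hmon X hX)
    simp only [pending]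
    omega
  | split H σ ρ σ₁ σ₂ η σ' d hm hn hρ hρσ h1 h2 hη hd hσ' =>
    simp only [SearchBound, pending, hm] at hs hq
    have hmode := hc.mode
    rw [hm] at hmode
    subst h1 h2
    obtain ⟨-, hs1, hs2⟩ := hc.split hmode.1 hmode.2 hn hρ hρσ hη hd hσ'
    have hbd : d.basis = c.basis := by subst hd; rfl
    have hoq : d.oq = c.oq + 1 := by subst hd; rfl
    have heq : d.eq = c.eq := by subst hd; rfl
    refine ⟨J, ⟨by simp only; omega, by simp only [hbd]; omega⟩, fun X hX => ?_⟩
    have := hq X (hmon X hX)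
    have := size_half_lt (by omega) hs2
    have hp : pending ({ d with mode := .search H σ' } : LConfig I O) =
        (overhang c.basis σ' - 1).size := by
      simp only [pending, hbd]
    rw [hp]
    change d.oq + _ ≤ _
    omega

/-- A query is a counterexample, or an access sequence of at most `c.basis.card` letters, possibly
followed by a suffix of an observed sequence. So each query adds at most the basis size to the
longest observation. -/
theorem LStep.length_le {M : FSM I O} {c c' : LConfig I O} (h : LStep M c c')
    (hc : c.Inv M) {l : ℕ} (hl : ∀ ρ ∈ c'.ces, ρ.length ≤ l)
    (hb : ∀ w, c.tree w ≠ none → w.length ≤ l + c.basis.card * c.oq) :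
    ∀ w, c'.tree w ≠ none → w.length ≤ l + c'.basis.card * c'.oq := by
  classical
  have hmulsucc : ∀ x y : ℕ, x * (y + 1) = x * y + x := fun x y => by ring
  have hquery : ∀ v : List I, v.length ≤ l + c.basis.card * c.oq + c.basis.card →
      ∀ w, (c.query M v).tree w ≠ none →
        w.length ≤ l + (c.query M v).basis.card * (c.query M v).oq := by
    intro v hv w hw
    simp only [query, hmulsucc]
    rcases ObsTree.observe_ne_none.1 hw with h | h
    · exact h.length_le.trans (by omega)
    · exact (hb w h).trans (by omega)
  have hfront : ∀ q, c.Frontier q → q.length ≤ c.basis.card := by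
    rintro q ⟨-, -, p, hp, i, rfl⟩
    have := length_lt_card hc.closed hp
    simp; omega
  cases h with
  | promote q hm hq' hiso =>
    intro w hw
    refine (hb w hw).trans ?_
    gcongr
    exact Finset.subset_insert _ _
  | extend q i hm hq' hn =>
    refine hquery _ ?_
    have := length_lt_card hc.closed hq'
    simp; omega
  | identify q r r' σ hm hq' hr hr' hne h1 h2 hw =>
    refine hquery _ ?_
    obtain ⟨a, b, ha, -⟩ := hw
    have := hb (r ++ σ) (by rw [ha]; simp)
    have := hfront q hq'
    simp at *; omega
  | inconsistent H σ hb' hσ => exact hb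
  | accept H hb' hcon heq => exact hb
  | refute H ρ σ hb' hcon hne hpre hσ hmin =>
    refine hquery _ ?_
    have := hl ρ (by simp)
    omega
  | finish H σ hm hσ => exact hb
  | split H σ ρ σ₁ σ₂ η σ' d hm hn hρ hρσ h1 h2 hη hd hσ' =>
    have hmode := hc.mode
    rw [hm] at hmode
    rw [hd]
    refine hquery _ ?_
    have h3 := length_lt_card hc.closed (hmode.1.reach_mem σ₁)
    obtain ⟨a, b, -, hb', -⟩ := hη
    have h4 := hb (σ ++ η) (by rw [hb']; simp)
    have h5 : σ₂.length ≤ σ.length := by rw [h2, List.length_drop]; omega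
    simp at *; omega

/-! ### Complete runs of `L#` -/

/-- The number of queries is bounded although it enters the bound itself through the length of the
observed sequences. -/
theorem query_bound {Q b k n l : ℕ} (hb : 1 ≤ b) (hbn : b ≤ n) (hk : k = 0 → b = 1)
    (hQ : Q ≤ b * k + b * k * b + (b - 1) * (1 + (max l (2 * n) + b * Q).size)) :
    (Q : ℝ) ≤ 50 * (k * (n : ℝ) ^ 2 + n * Real.log l) := by
  have hlogl : 0 ≤ Real.log l := Real.log_natCast_nonneg l
  -- For `k = 0` the target lacks the `n ^ 2` term that absorbs the lower-order terms; but then the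
  -- basis is a singleton and no query is posed.
  rcases Nat.eq_zero_or_pos k with rfl | hk0
  · obtain rfl := hk rfl
    have : Q = 0 := by simpa using hQ
    subst this
    simp only [Nat.cast_zero]
    positivity
  set X := max l (2 * n) + b * Q with hX
  have hX1 : 1 ≤ X := by have := le_max_right l (2 * n); omega
  have hn1 : (1 : ℝ) ≤ n := by exact_mod_cast hb.trans hbn
  have hk1 : (1 : ℝ) ≤ k := by exact_mod_cast hk0
  have hQ0 : (0 : ℝ) ≤ Q := Nat.cast_nonneg Q
  have hQ' : Q ≤ n * k + n * k * n + n * (1 + X.size) := by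
    refine hQ.trans ?_
    gcongr
    omega
  -- `X.size` is `⌊log₂ X⌋ + 1`, and `1 / log 2 < 2`.
  have hsize : (X.size : ℝ) ≤ 1 + 2 * Real.log X := by
    have h1 : 2 ^ (X.size - 1) ≤ X := Nat.lt_size.1 (by have := Nat.size_pos.2 hX1; omega)
    have h2 : ((X.size - 1 : ℕ) : ℝ) * Real.log 2 ≤ Real.log X := by
      rw [← Real.log_pow]
      exact Real.log_le_log (by positivity) (by exact_mod_cast h1)
    have h3 : (X.size : ℝ) ≤ ((X.size - 1 : ℕ) : ℝ) + 1 := by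
      have : X.size ≤ X.size - 1 + 1 := by omega
      exact_mod_cast this
    have h4 := Real.log_two_gt_d9
    have h5 : (0 : ℝ) ≤ ((X.size - 1 : ℕ) : ℝ) := Nat.cast_nonneg _
    nlinarith
  -- `max l 1` keeps the product positive for `l = 0` without changing the logarithm, as `Real.log 0
  -- = 0`.
  have hl1 : (1 : ℝ) ≤ ((max l 1 : ℕ) : ℝ) := by exact_mod_cast le_max_right l 1
  have hlogmax : Real.log ((max l 1 : ℕ) : ℝ) = Real.log l := by
    rcases Nat.eq_zero_or_pos l with rfl | h
    · simp
    · rw [max_eq_left h]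
  have hXle : (X : ℝ) ≤ ((max l 1 : ℕ) : ℝ) * (3 * n * (1 + Q)) := by
    have h : X ≤ max l 1 * (3 * n * (1 + Q)) := by
      have h1 : max l (2 * n) ≤ max l 1 * (3 * n) := by
        have : 1 ≤ max l 1 := le_max_right _ _
        have : l ≤ max l 1 := le_max_left _ _
        refine max_le ?_ ?_ <;> nlinarith
      have h2 : b * Q ≤ max l 1 * (3 * n) * Q := by
        gcongr
        have : 1 ≤ max l 1 := le_max_right _ _
        nlinarith
      calc X ≤ max l 1 * (3 * n) + max l 1 * (3 * n) * Q := add_le_add h1 h2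
        _ = _ := by ring
    exact_mod_cast h
  have hlogX : Real.log X ≤ Real.log l + Real.log (3 * n) + Real.log (1 + Q) := by
    refine (Real.log_le_log (by exact_mod_cast hX1) hXle).trans ?_
    rw [Real.log_mul (by positivity) (by positivity), Real.log_mul (by positivity) (by positivity),
      hlogmax]
    linarith
  have hlog1 : Real.log (3 * n) ≤ 3 * n := Real.log_le_self (by positivity)
  -- Splitting off the factor `8 * n` before applying `log x ≤ x` leaves the coefficient `1 / 8`.
  -- Doubled in `hmain` it is `1 / 4`, which the left side `Q` absorbs.
  have hlog2 : n * Real.log (1 + Q) ≤ (1 + Q) / 8 + 8 * (n : ℝ) ^ 2 := by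
    have h1 : Real.log (1 + Q) = Real.log ((1 + Q) / (8 * n)) + Real.log (8 * n) := by
      rw [← Real.log_mul (by positivity) (by positivity)]
      congr 1
      field_simp
    have h2 : Real.log ((1 + Q) / (8 * n)) ≤ (1 + Q) / (8 * n) :=
      Real.log_le_self (by positivity)
    have h3 : Real.log (8 * (n : ℝ)) ≤ 8 * n := Real.log_le_self (by positivity)
    calc n * Real.log (1 + Q) ≤ n * ((1 + Q) / (8 * n) + 8 * n) := by
          rw [h1]; gcongr
      _ = _ := by field_simp
  have hQr : (Q : ℝ) ≤ n * k + n * k * n + n * (1 + X.size) := by exact_mod_cast hQ'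
  have hmain : (n : ℝ) * (1 + X.size) ≤
      n * (2 + 2 * (Real.log l + 3 * n)) + 2 * ((1 + Q) / 8 + 8 * (n : ℝ) ^ 2) := by
    have : (n : ℝ) * (1 + X.size) ≤
        n * (2 + 2 * (Real.log l + 3 * n)) + 2 * (n * Real.log (1 + Q)) := by
      have h : (1 + X.size : ℝ) ≤ 2 + 2 * (Real.log l + 3 * n) + 2 * Real.log (1 + Q) := by
        linarith
      nlinarith
    linarith
  have hnn : (n : ℝ) ≤ (n : ℝ) ^ 2 := by nlinarith
  have hnk : (n : ℝ) ^ 2 ≤ k * (n : ℝ) ^ 2 := by nlinarith [sq_nonneg (n : ℝ)]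
  have hnk' : (n : ℝ) * k ≤ k * (n : ℝ) ^ 2 := by nlinarith
  have hnl : 0 ≤ (n : ℝ) * Real.log l := by positivity
  nlinarith

/-- The configurations that `L#` reaches on `M` from a tree initialised with `L`. -/
def LReach (M : FSM I O) (L : List (List I)) : LConfig I O → Prop :=
  Relation.ReflTransGen (LStep M) (init M L)

theorem LReach.inv {M : FSM I O} {L : List (List I)} {c : LConfig I O} (h : LReach M L c) :
    c.Inv M := by
  induction h with
  | refl => exact inv_init M L
  | tail _ h ih => exact h.inv ih

theorem LReach.exists_cost [Finite I] {M : FSM I O} {L : List (List I)} {c : LConfig I O}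
    (h : LReach M L c) : ∃ J, c.Cost J := by
  induction h with
  | refl => exact ⟨0, cost_init M L⟩
  | tail h h' ih =>
    obtain ⟨J, hJ⟩ := ih
    exact h'.cost (LReach.inv h) hJ

theorem LStep.ces_subset {M : FSM I O} {c c' : LConfig I O} (h : LStep M c c') :
    c.ces ⊆ c'.ces := by
  cases h <;> first | exact List.Subset.refl _ | exact List.subset_cons_self _ _ | skip
  subst_vars
  exact List.Subset.refl _

theorem LReach.length_le {M : FSM I O} {L : List (List I)} {c : LConfig I O}
    (h : LReach M L c) {l : ℕ} (hL : ∀ w ∈ L, w.length ≤ l) (hl : ∀ ρ ∈ c.ces, ρ.length ≤ l) :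
    ∀ w, c.tree w ≠ none → w.length ≤ l + c.basis.card * c.oq := by
  induction h with
  | refl =>
    intro w hw
    exact (ObsTree.length_le_of_ofLog M L hL w hw).trans (Nat.le_add_right _ _)
  | tail h h' ih =>
    exact h'.length_le (LReach.inv h) hl (ih fun ρ hρ => hl ρ (h'.ces_subset hρ))

theorem LReach.equivalent {M : FSM I O} {L : List (List I)} {c : LConfig I O} {H : Hyp I O}
    (h : LReach M L c) (hd : c.mode = .done H) : H.toFSM.Equivalent M := by
  have := h.inv.mode
  rw [hd] at this
  exact this.2

/-- The numbers of queries that `L#` poses. -/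
theorem LReach.bounds [Finite I] {M N : FSM I O} {L : List (List I)} {c : LConfig I O}
    {H : Hyp I O} (h : LReach M L c) (hd : c.mode = .done H) (hN : N.Equivalent M) {n l : ℕ}
    (hn : N.size ≤ n) (hl : ∀ ρ ∈ c.ces, ρ.length ≤ l)
    (hL : ∀ w ∈ L, w.length ≤ max l (2 * n)) :
    (c.oq : ℝ) ≤ 50 * (Nat.card I * (n : ℝ) ^ 2 + n * Real.log l) ∧ c.eq ≤ n := by
  obtain ⟨J, hs, hq⟩ := h.exists_cost
  simp only [SearchBound, hd] at hs
  have hbn : c.basis.card ≤ n := (h.inv.card_le hN).trans hn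
  refine ⟨?_, by omega⟩
  have hX := hq _ (h.length_le hL fun ρ hρ => (hl ρ hρ).trans (le_max_left _ _))
  refine query_bound (b := c.basis.card) (by omega) hbn (fun hk => ?_) ?_
  · have : IsEmpty I := by
      rcases Nat.card_eq_zero.1 hk with h | h
      · exact h
      · exact absurd h (by simpa using ‹Finite I›)
    have : c.basis.card ≤ 1 := Finset.card_le_one_of_subsingleton _
    omega
  · have h1 := c.knowledge_le
    have h2 : J * (1 + (max l (2 * n) + c.basis.card * c.oq).size) ≤
        (c.basis.card - 1) * (1 + (max l (2 * n) + c.basis.card * c.oq).size) := by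
      gcongr
      omega
    omega

/-! ### Termination -/

theorem terminates_of_acc {α : Type*} {Step : α → α → Prop} {a : α}
    (h : Acc (fun b a => Step a b) a) : Terminates Step a := by
  induction h with
  | intro a _ ih =>
    rintro ⟨f, rfl, hf⟩
    exact ih (f 1) (hf 0) ⟨fun t => f (t + 1), rfl, fun t => hf (t + 1)⟩

/-- The outer induction is on the number of untreated implementations, the inner one (`hlearn`) on
the accessibility of the configurations of `L#`. -/
theorem acc_repeatStep [Finite I] (n : ℕ) (s : RunState I O) (hn : s.todo.length = n)
    (hp : s.phase = .idle) : Acc (fun s' s => RepeatStep s s') s := by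
  induction n generalizing s with
  | zero =>
    have := List.length_eq_zero_iff.1 hn
    refine ⟨_, fun s' h => ?_⟩
    cases h <;> simp_all
  | succ n ih =>
    have hlearn : ∀ (A : FSM I O) (c : LConfig I O), Acc (fun c' c => LStep A c c') c →
        ∀ (s : RunState I O) (As : List (FSM I O)), s.todo = A :: As → As.length = n →
          s.phase = .learn c → Acc (fun s' s => RepeatStep s s') s := by
      intro A c hc
      induction hc with
      | intro c _ ihc =>
        intro s As ht hl hp
        refine ⟨_, fun s' h => ?_⟩
        cases h with
        | start B Bs h1 h2 => simp_all
        | learn B Bs d d' h1 h2 h3 =>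
          obtain ⟨rfl, rfl⟩ := List.cons.inj (ht.symm.trans h2)
          obtain rfl := Phase.learn.inj (hp.symm.trans h1)
          exact ihc d' h3 _ As ht hl rfl
        | add d H h1 h2 h3 =>
          exact ih _ (by simp [RunState.assign, RunState.charge, ht, hl]) rfl
        | known d H M h1 h2 h3 h4 =>
          exact ih _ (by simp [RunState.assign, RunState.charge, ht, hl]) rfl
    refine ⟨_, fun s' h => ?_⟩
    cases h with
    | start A As h1 h2 =>
      exact hlearn A _ (inv_init A []).acc _ As h2 (by simpa [h2] using hn) rfl
    | _ => simp_all

theorem acc_incStep [Finite I] (n : ℕ) (s : RunState I O) (hn : s.todo.length = n)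
    (hp : s.phase = .idle) : Acc (fun s' s => IncStep s s') s := by
  induction n generalizing s with
  | zero =>
    have := List.length_eq_zero_iff.1 hn
    refine ⟨_, fun s' h => ?_⟩
    cases h <;> simp_all
  | succ n ih =>
    have hlearn : ∀ (A : FSM I O) (c : LConfig I O), Acc (fun c' c => LStep A c c') c →
        ∀ (s : RunState I O) (As : List (FSM I O)), s.todo = A :: As → As.length = n →
          s.phase = .learn c → Acc (fun s' s => IncStep s s') s := by
      intro A c hc
      induction hc with
      | intro c _ ihc =>
        intro s As ht hl hp
        refine ⟨_, fun s' h => ?_⟩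
        cases h with
        | learn B Bs d d' h1 h2 h3 =>
          obtain ⟨rfl, rfl⟩ := List.cons.inj (ht.symm.trans h2)
          obtain rfl := Phase.learn.inj (hp.symm.trans h1)
          exact ihc d' h3 _ As ht hl rfl
        | add d H h1 h2 =>
          exact ih _ (by simp [RunState.assign, RunState.charge, ht, hl]) rfl
        | _ => simp_all
    have hcall : ∀ (s : RunState I O) (L : List (List I)), s.todo.length = n + 1 →
        s.phase = .call L → Acc (fun s' s => IncStep s s') s := by
      intro s L hl hp
      refine ⟨_, fun s' h => ?_⟩
      cases h with
      | call A As L L' h1 h2 h3 =>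
        exact hlearn A _ (inv_init A L').acc _ As h2 (by simpa [h2] using hl) rfl
      | _ => simp_all
    have hcheck : ∀ (s : RunState I O) (M : FSM I O) (L : List (List I)),
        s.todo.length = n + 1 → s.phase = .check M L → Acc (fun s' s => IncStep s s') s := by
      intro s M L hl hp
      refine ⟨_, fun s' h => ?_⟩
      cases h with
      | pass A As N L h1 h2 h3 => exact ih _ (by simp [RunState.assign, hl]) rfl
      | fail A As N L h1 h2 h3 => exact hcall _ L hl rfl
      | _ => simp_all
    refine ⟨_, fun s' h => ?_⟩
    cases h with
    | first A As h1 h2 h3 => exact hcall _ _ hn rfl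
    | fpNone A As F L h1 h2 h3 h4 h5 => exact hcall _ _ hn rfl
    | fpSome A As F L M h1 h2 h3 h4 h5 => exact hcheck _ _ _ hn rfl
    | _ => simp_all

/-! ### Fingerprinting -/

theorem exists_isSepSeq (Ms : List (FSM I O)) : ∃ F, IsSepSeq Ms F := by
  classical
  let s : FSM I O → FSM I O → List I := fun M N => Classical.epsilon fun w => FSM.Separates w M N
  refine ⟨(((Ms ×ˢ Ms).filter fun x => ¬ x.1.Equivalent x.2).map fun x => s x.1 x.2).dedup,
    List.nodup_dedup _, s, fun M N => ?_, fun M _ N _ h => ?_, fun w => ?_⟩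
  -- The chosen sequence depends only on the predicate, and separation is symmetric in the two
  -- machines.
  · change Classical.epsilon _ = Classical.epsilon _
    congr 1
    funext w
    exact propext ne_comm
  · unfold FSM.Equivalent at h
    push Not at h
    exact Classical.epsilon_spec h
  · simp only [List.mem_dedup, List.mem_map, List.mem_filter, Prod.exists, List.mem_product,
      decide_eq_true_eq]
    constructor
    · rintro ⟨M, N, ⟨⟨hM, hN⟩, h⟩, rfl⟩
      exact ⟨M, hM, N, hN, h, rfl⟩
    · rintro ⟨M, hM, N, hN, h, rfl⟩
      exact ⟨M, N, ⟨⟨hM, hN⟩, h⟩, rfl⟩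

theorem IsSepSeq.length_le {Ms : List (FSM I O)} {F : List (List I)} (h : IsSepSeq Ms F) :
    F.length ≤ Ms.length ^ 2 := by
  obtain ⟨hnd, s, -, -, hF⟩ := h
  have hsub : F ⊆ (Ms ×ˢ Ms).map fun x => s x.1 x.2 := by
    intro w hw
    obtain ⟨M, hM, N, hN, -, rfl⟩ := (hF w).1 hw
    exact List.mem_map.2 ⟨(M, N), by simp [hM, hN], rfl⟩
  have := (List.subperm_of_subset hnd hsub).length_le
  rwa [List.length_map, List.length_product, ← sq] at this

theorem runFingerprint_length_le (A : FSM I O) (Ms : List (FSM I O)) (F : List (List I)) :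
    (runFingerprint A Ms F).2.length ≤ F.length := by
  induction F generalizing Ms with
  | nil => simp [runFingerprint]
  | cons w F ih =>
    unfold runFingerprint
    split_ifs
    · simp
    · simpa using ih _

theorem runFingerprint_sublist (A : FSM I O) (Ms : List (FSM I O)) (F : List (List I)) :
    (runFingerprint A Ms F).1.Sublist Ms := by
  induction F generalizing Ms with
  | nil => simp [runFingerprint]
  | cons w F ih =>
    unfold runFingerprint
    split_ifs
    · simp
    · exact (ih _).trans List.filter_sublist

/-- Models that are ruled out are not equivalent to the implementation. -/
theorem mem_runFingerprint {A : FSM I O} {Ms : List (FSM I O)} {M : FSM I O} (hM : M ∈ Ms)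
    (h : A.Equivalent M) (F : List (List I)) : M ∈ (runFingerprint A Ms F).1 := by
  induction F generalizing Ms with
  | nil => simpa [runFingerprint] using hM
  | cons w F ih =>
    unfold runFingerprint
    split_ifs
    · exact hM
    · exact ih (List.mem_filter.2 ⟨hM, by simpa using (h w).symm⟩)

/-- The run stops early only with at most one model left; otherwise every sequence of `F` has served
as a filter. -/
theorem runFingerprint_agrees (A : FSM I O) (Ms : List (FSM I O)) (F : List (List I)) :
    (runFingerprint A Ms F).1.length ≤ 1 ∨
      ∀ M ∈ (runFingerprint A Ms F).1, ∀ w ∈ F, M.output w = A.output w := by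
  classical
  induction F generalizing Ms with
  | nil => simp
  | cons w F ih =>
    unfold runFingerprint
    split_ifs with h
    · exact .inl h
    · refine (ih _).imp id fun h' M hM v hv => ?_
      rcases List.mem_cons.1 hv with rfl | hv
      · have := (runFingerprint_sublist A _ F).subset hM
        simpa using (List.mem_filter.1 this).2
      · exact h' M hM v hv

/-- Two survivors of all tests would agree with `A`, hence with each other, on the sequence that
separates them. -/
theorem runFingerprint_length_le_one {A : FSM I O} {Ms : List (FSM I O)} {F : List (List I)}
    (hF : IsSepSeq Ms F) (hMs : Ms.Pairwise fun M N => ¬ M.Equivalent N) :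
    (runFingerprint A Ms F).1.length ≤ 1 := by
  rcases runFingerprint_agrees A Ms F with h | h
  · exact h
  have hsub := runFingerprint_sublist A Ms F
  have hpw := hMs.sublist hsub
  obtain ⟨-, s, -, hs, hF⟩ := hF
  match hR : (runFingerprint A Ms F).1 with
  | [] => simp
  | [_] => simp
  | M :: N :: R =>
    rw [hR] at h hsub hpw
    have hne : ¬ M.Equivalent N := (List.pairwise_cons.1 hpw).1 N (by simp)
    have hM : M ∈ Ms := hsub.subset (by simp)
    have hN : N ∈ Ms := hsub.subset (by simp)
    have hw := (hF (s M N)).2 ⟨M, hM, N, hN, hne, rfl⟩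
    exact absurd ((h M (by simp) _ hw).trans (h N (by simp) _ hw).symm) (hs M hM N hN hne)

/-! ### Correctness and costs of the runs -/

/-- The results of a run for the implementations that have been treated. -/
structure Partial (As M₀ : List (FSM I O)) (s : RunState I O) : Prop where
  distinct : s.models.Pairwise fun M N => ¬ M.Equivalent N
  references : M₀ ⊆ s.models
  sound : ∀ M ∈ s.models, M ∈ M₀ ∨ ∃ A ∈ As, A.Equivalent M
  assigned : ∃ Ds, As = Ds ++ s.todo ∧
    List.Forall₂ (fun A N => N ∈ s.models ∧ A.Equivalent N) Ds s.assigned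

theorem partial_start (As : List (FSM I O)) {M₀ : List (FSM I O)}
    (h : M₀.Pairwise fun M N => ¬ M.Equivalent N) : Partial As M₀ (RunState.start As M₀) where
  distinct := h
  references := List.Subset.refl _
  sound _ hM := .inl hM
  assigned := ⟨[], rfl, .nil⟩

theorem Partial.congr {As M₀ : List (FSM I O)} {s s' : RunState I O} (h : Partial As M₀ s)
    (hm : s'.models = s.models) (ht : s'.todo = s.todo) (ha : s'.assigned = s.assigned) :
    Partial As M₀ s' where
  distinct := hm ▸ h.distinct
  references := hm ▸ h.references
  sound := hm ▸ h.sound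
  assigned := by rw [hm, ht, ha]; exact h.assigned

theorem Partial.assign {As M₀ : List (FSM I O)} {s : RunState I O} (h : Partial As M₀ s)
    {A : FSM I O} {Bs : List (FSM I O)} (ht : s.todo = A :: Bs) {M : FSM I O}
    (hM : M ∈ s.models) (hA : A.Equivalent M) : Partial As M₀ (s.assign M) where
  distinct := h.distinct
  references := h.references
  sound := h.sound
  assigned := by
    obtain ⟨Ds, hAs, hDs⟩ := h.assigned
    refine ⟨Ds ++ [A], by simp [RunState.assign, hAs, ht], ?_⟩
    exact List.rel_append hDs (.cons ⟨hM, hA⟩ .nil)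

theorem Partial.add {As M₀ : List (FSM I O)} {s : RunState I O} (h : Partial As M₀ s)
    {A : FSM I O} {Bs : List (FSM I O)} (ht : s.todo = A :: Bs) {M : FSM I O}
    (hM : ∀ N ∈ s.models, ¬ N.Equivalent M) (hA : A.Equivalent M) :
    Partial As M₀ { s with models := s.models ++ [M] } where
  distinct := by
    refine List.pairwise_append.2 ⟨h.distinct, List.pairwise_singleton _ _, fun N hN P hP => ?_⟩
    obtain rfl := List.mem_singleton.1 hP
    exact hM N hN
  references := List.subset_append_of_subset_left _ h.references
  sound N hN := by
    rcases List.mem_append.1 hN with hN | hN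
    · exact h.sound N hN
    · obtain rfl := List.mem_singleton.1 hN
      obtain ⟨Ds, hAs, -⟩ := h.assigned
      exact .inr ⟨A, by simp [hAs, ht], hA⟩
  assigned := by
    obtain ⟨Ds, hAs, hDs⟩ := h.assigned
    exact ⟨Ds, hAs, hDs.imp fun _ _ h => ⟨List.mem_append_left _ h.1, h.2⟩⟩

theorem Partial.length_assigned {As M₀ : List (FSM I O)} {s : RunState I O}
    (h : Partial As M₀ s) (ht : s.todo = []) : s.assigned.length = As.length := by
  obtain ⟨Ds, hAs, hDs⟩ := h.assigned
  rw [← hDs.length_eq, hAs, ht, List.append_nil]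

theorem Partial.solves {As M₀ : List (FSM I O)} {s : RunState I O}
    (h : Partial As M₀ s) (ht : s.todo = []) : Solves As M₀ s.models s.assigned where
  distinct := h.distinct
  references := h.references
  sound := h.sound
  assigned := by
    obtain ⟨Ds, hAs, hDs⟩ := h.assigned
    rw [ht, List.append_nil] at hAs
    rw [hAs]
    refine hDs.imp fun A N hAN => ⟨hAN.1, fun M hM => ⟨?_, fun hAM => ?_⟩⟩
    · rintro rfl
      exact hAN.2
    · by_contra hne
      have hsymm : Std.Symm fun M N : FSM I O => ¬ M.Equivalent N :=
        ⟨fun M N h h' => h h'.symm⟩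
      exact h.distinct.forall hAN.1 hM hne (hAN.2.symm.trans hAM)

/-- The bound for the output queries of a call of `L#`. -/
noncomputable def callBound (I : Type u) (n l : ℕ) : ℝ :=
  50 * (Nat.card I * (n : ℝ) ^ 2 + n * Real.log l)

theorem callBound_nonneg (I : Type u) (n l : ℕ) : 0 ≤ callBound I n l := by
  have := Real.log_natCast_nonneg l
  unfold callBound
  positivity

/-- What holds in the phases of repeated `L#`. -/
def RepeatPhase (s : RunState I O) : Phase I O → Prop
  | .idle => True
  | .learn c => ∃ A As, s.todo = A :: As ∧ LReach A [] c
  | _ => False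

/-- The invariant of repeated `L#`. -/
structure RepeatInv (As : List (FSM I O)) (s : RunState I O) : Prop where
  result : Partial As [] s
  phase : RepeatPhase s s.phase
  cost : ∀ n l : ℕ, (∀ M ∈ s.models, M.size ≤ n) → (∀ ρ ∈ s.ces, ρ.length ≤ l) →
    s.oq ≤ s.assigned.length * callBound I n l ∧ s.eq ≤ s.assigned.length * n

/-- In the invariant `n` and `l` are quantified inside `cost`: models and counterexamples only
accumulate, so bounds for the later lists hold for the earlier ones. If the learned model is
discarded, the known model equivalent to it provides the size bound. -/
theorem RepeatInv.step [Finite I] {As : List (FSM I O)} {s s' : RunState I O}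
    (hs : RepeatInv As s) (h : RepeatStep s s') : RepeatInv As s' := by
  obtain ⟨hr, hp, hc⟩ := hs
  cases h with
  | start A Bs h1 h2 =>
    exact ⟨hr.congr rfl rfl rfl, ⟨A, Bs, h2, .refl⟩, hc⟩
  | learn A Bs c c' h1 h2 h3 =>
    rw [h1] at hp
    obtain ⟨B, Cs, h4, h5⟩ := hp
    obtain ⟨rfl, rfl⟩ := List.cons.inj (h2.symm.trans h4)
    exact ⟨hr.congr rfl rfl rfl, ⟨A, Bs, h2, h5.tail h3⟩, hc⟩
  | add c H h1 h2 h3 =>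
    rw [h1] at hp
    obtain ⟨A, Bs, h4, h5⟩ := hp
    have heq := (h5.equivalent h2).symm
    refine ⟨?_, trivial, fun n l hn hl => ?_⟩
    · refine (Partial.add (s := s.charge c) (hr.congr rfl rfl rfl) h4 h3 heq).assign h4 (by simp) heq
    · have hH : H.toFSM.size ≤ n := hn _ (by simp [RunState.assign])
      obtain ⟨h6, h7⟩ := hc n l (fun M hM => hn M (by simp [RunState.assign, RunState.charge, hM]))
        (fun ρ hρ => hl ρ (by simp [RunState.assign, RunState.charge, hρ]))
      obtain ⟨h8, h9⟩ := h5.bounds h2 heq.symm hH (l := l)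
        (fun ρ hρ => hl ρ (by simp [RunState.assign, RunState.charge, hρ])) (by simp)
      simp only [RunState.assign, RunState.charge, List.length_append, List.length_singleton,
        Nat.cast_add, Nat.cast_one, add_mul, one_mul]
      exact ⟨add_le_add h6 h8, add_le_add h7 h9⟩
  | known c H M h1 h2 h3 h4 =>
    rw [h1] at hp
    obtain ⟨A, Bs, h10, h5⟩ := hp
    have heq := h4.trans (h5.equivalent h2)
    refine ⟨?_, trivial, fun n l hn hl => ?_⟩
    · exact Partial.assign (s := s.charge c) (hr.congr rfl rfl rfl) h10 h3 heq.symm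
    · obtain ⟨h6, h7⟩ := hc n l (fun M hM => hn M hM)
        (fun ρ hρ => hl ρ (by simp [RunState.assign, RunState.charge, hρ]))
      obtain ⟨h8, h9⟩ := h5.bounds h2 heq (hn M h3) (l := l)
        (fun ρ hρ => hl ρ (by simp [RunState.assign, RunState.charge, hρ])) (by simp)
      simp only [RunState.assign, RunState.charge, List.length_append, List.length_singleton,
        Nat.cast_add, Nat.cast_one, add_mul, one_mul]
      exact ⟨add_le_add h6 h8, add_le_add h7 h9⟩

theorem repeatInv_of_reach [Finite I] {As : List (FSM I O)} {s : RunState I O}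
    (h : Relation.ReflTransGen RepeatStep (RunState.start As []) s) : RepeatInv As s := by
  induction h with
  | refl => exact ⟨partial_start As .nil, trivial, fun n l _ _ => by simp [RunState.start]⟩
  | tail _ h ih => exact ih.step h

/-- Repeated `L#` stops only when all implementations have been treated. -/
theorem RepeatInv.finished {As : List (FSM I O)} {s : RunState I O} (hs : RepeatInv As s)
    (h : ∀ s', ¬ RepeatStep s s') : s.todo = [] ∧ s.phase = .idle := by
  have hp := hs.phase
  match hph : s.phase with
  | .idle =>
    refine ⟨?_, rfl⟩
    match ht : s.todo with
    | [] => rfl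
    | A :: Bs => exact absurd (.start s A Bs hph ht) (h _)
  | .learn c =>
    rw [hph] at hp
    obtain ⟨A, Bs, ht, hr⟩ := hp
    exfalso
    by_cases hd : ∃ H, c.mode = .done H
    · obtain ⟨H, hd⟩ := hd
      by_cases hM : ∃ M ∈ s.models, M.Equivalent H.toFSM
      · obtain ⟨M, hM, heq⟩ := hM
        exact h _ (.known s c H M hph hd hM heq)
      · push Not at hM
        exact h _ (.add s c H hph hd hM)
    · push Not at hd
      obtain ⟨c', hc'⟩ := hr.inv.exists_step hd
      exact h _ (.learn s A Bs c c' hph ht hc')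
  | .check M L => rw [hph] at hp; exact hp.elim
  | .call L => rw [hph] at hp; exact hp.elim

/-- What holds in the phases of `IncrementalFingerprinting`. -/
def IncPhase (s : RunState I O) : Phase I O → Prop
  | .idle => True
  | .check M _ => ∃ A As, s.todo = A :: As ∧ M ∈ s.models ∧
      ∀ N ∈ s.models, A.Equivalent N → N = M
  | .call _ => ∃ A As, s.todo = A :: As ∧ ∀ N ∈ s.models, ¬ A.Equivalent N
  | .learn c => ∃ A As, s.todo = A :: As ∧ (∀ N ∈ s.models, ¬ A.Equivalent N) ∧
      ∃ L, LReach A L c ∧ L ⊆ s.reused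

/-- The number of implementations that are being treated. -/
def Phase.active : Phase I O → ℕ
  | .idle => 0
  | _ => 1

/-- A bound for the number of conformance queries for the current implementation. -/
def Phase.checked : Phase I O → ℕ
  | .idle => 0
  | .check _ _ => 0
  | _ => 1

/-- The invariant of `IncrementalFingerprinting`. -/
structure IncInv (As M₀ : List (FSM I O)) (s : RunState I O) : Prop where
  result : Partial As M₀ s
  phase : IncPhase s s.phase
  cost : ∀ n l : ℕ, (∀ M ∈ s.models, M.size ≤ n) → (∀ ρ ∈ s.ces, ρ.length ≤ l) →
    (∀ w ∈ s.reused, w.length ≤ max l (2 * n)) →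
    s.oq ≤ s.models.length * callBound I n l +
      ((s.assigned.length + s.phase.active : ℕ) : ℝ) * (s.models.length : ℝ) ^ 2 ∧
    s.eq ≤ s.models.length * n + s.assigned.length + s.phase.checked

/-- The phases `call` and `learn` carry the fact that no model is equivalent to the implementation.
So each return of `L#` adds an inequivalent model, and its cost is charged to that model;
fingerprinting and the conformance query are charged to the implementation. -/
theorem IncInv.step [Finite I] {As M₀ : List (FSM I O)} {s s' : RunState I O}
    (hs : IncInv As M₀ s) (h : IncStep s s') : IncInv As M₀ s' := by
  obtain ⟨hr, hp, hc⟩ := hs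
  have hfp : ∀ {A : FSM I O} {F L : List (List I)} {R : List (FSM I O)}, IsSepSeq s.models F →
      runFingerprint A s.models F = (R, L) → (L.length : ℝ) ≤ (s.models.length : ℝ) ^ 2 := by
    intro A F L R hF hrun
    have h1 := runFingerprint_length_le A s.models F
    rw [hrun] at h1
    exact_mod_cast h1.trans hF.length_le
  cases h with
  | first A Bs h1 h2 h3 =>
    refine ⟨hr.congr rfl rfl rfl, ⟨A, Bs, h2, by simp [h3]⟩, fun n l hn hl hw => ?_⟩
    have := hc n l hn hl hw
    simp only [h1, h3, Phase.active, Phase.checked, List.length_nil] at this ⊢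
    exact ⟨by simpa using this.1, by omega⟩
  | fpNone A Bs F L h1 h2 h3 h4 h5 =>
    refine ⟨hr.congr rfl rfl rfl, ⟨A, Bs, h2, fun N hN heq => ?_⟩, fun n l hn hl hw => ?_⟩
    · have := mem_runFingerprint hN heq F
      rw [h5] at this
      simp at this
    · have := hc n l hn hl hw
      have hL := hfp h4 h5
      simp only [h1, Phase.active, Phase.checked] at this ⊢
      push_cast at this ⊢
      exact ⟨by linarith, by omega⟩
  | fpSome A Bs F L M h1 h2 h3 h4 h5 =>
    refine ⟨hr.congr rfl rfl rfl, ⟨A, Bs, h2, ?_, fun N hN heq => ?_⟩, fun n l hn hl hw => ?_⟩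
    · have := (runFingerprint_sublist A s.models F).subset
      rw [h5] at this
      exact this (by simp)
    · have := mem_runFingerprint hN heq F
      rw [h5] at this
      simpa using this
    · have := hc n l hn hl hw
      have hL := hfp h4 h5
      simp only [h1, Phase.active, Phase.checked] at this ⊢
      push_cast at this ⊢
      exact ⟨by linarith, by omega⟩
  | pass A Bs M L h1 h2 h3 =>
    rw [h1] at hp
    obtain ⟨B, Cs, h4, h5, -⟩ := hp
    refine ⟨Partial.assign (s := { s with eq := s.eq + 1 }) (hr.congr rfl rfl rfl) h2 h5 h3,
      trivial, fun n l hn hl hw => ?_⟩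
    have := hc n l hn hl hw
    simp only [h1, Phase.active, Phase.checked, RunState.assign, List.length_append,
      List.length_singleton] at this ⊢
    exact ⟨this.1, by omega⟩
  | fail A Bs M L h1 h2 h3 =>
    rw [h1] at hp
    obtain ⟨B, Cs, h4, h5, h6⟩ := hp
    obtain ⟨rfl, rfl⟩ := List.cons.inj (h2.symm.trans h4)
    -- Fingerprinting left `M` as the only candidate, and `M` has failed.
    refine ⟨hr.congr rfl rfl rfl, ⟨A, Bs, h2, fun N hN heq => h3 (h6 N hN heq ▸ heq)⟩,
      fun n l hn hl hw => ?_⟩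
    have := hc n l hn hl hw
    simp only [h1, Phase.active, Phase.checked] at this ⊢
    exact ⟨this.1, by omega⟩
  | call A Bs L L' h1 h2 h3 =>
    rw [h1] at hp
    obtain ⟨B, Cs, h4, h5⟩ := hp
    obtain ⟨rfl, rfl⟩ := List.cons.inj (h2.symm.trans h4)
    refine ⟨hr.congr rfl rfl rfl, ⟨A, Bs, h2, h5, L', .refl, List.subset_append_left _ _⟩,
      fun n l hn hl hw => ?_⟩
    have := hc n l hn hl fun w hw' => hw w (List.mem_append_right _ hw')
    simpa only [h1, Phase.active, Phase.checked] using this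
  | learn A Bs c c' h1 h2 h3 =>
    rw [h1] at hp
    obtain ⟨B, Cs, h4, h5, L, h6, h7⟩ := hp
    obtain ⟨rfl, rfl⟩ := List.cons.inj (h2.symm.trans h4)
    refine ⟨hr.congr rfl rfl rfl, ⟨A, Bs, h2, h5, L, h6.tail h3, h7⟩, fun n l hn hl hw => ?_⟩
    have := hc n l hn hl hw
    simpa only [h1, Phase.active, Phase.checked] using this
  | add c H h1 h2 =>
    rw [h1] at hp
    obtain ⟨A, Bs, h4, h3, L, h5, hL⟩ := hp
    have heq := (h5.equivalent h2).symm
    refine ⟨?_, trivial, fun n l hn hl hw => ?_⟩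
    · exact (Partial.add (s := s.charge c) (hr.congr rfl rfl rfl) h4
        (fun N hN h => h3 N hN (heq.trans h.symm)) heq).assign h4 (by simp) heq
    · have hH : H.toFSM.size ≤ n := hn _ (by simp [RunState.assign])
      obtain ⟨h6, h7⟩ := hc n l (fun M hM => hn M (by simp [RunState.assign, RunState.charge, hM]))
        (fun ρ hρ => hl ρ (by simp [RunState.assign, RunState.charge, hρ])) hw
      obtain ⟨h8, h9⟩ := h5.bounds h2 heq.symm hH (l := l)
        (fun ρ hρ => hl ρ (by simp [RunState.assign, RunState.charge, hρ])) fun w hw' => hw w (hL hw')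
      change (c.oq : ℝ) ≤ callBound I n l at h8
      simp only [h1, Phase.active, Phase.checked, RunState.assign, RunState.charge,
        List.length_append, List.length_singleton] at h6 h7 ⊢
      push_cast at h6 ⊢
      refine ⟨?_, by rw [add_mul]; omega⟩
      have hm : (0 : ℝ) ≤ s.models.length := Nat.cast_nonneg _
      have ha : (0 : ℝ) ≤ s.assigned.length := Nat.cast_nonneg _
      -- Earlier fingerprints were charged with fewer models; the charge only rises when a model is
      -- added.
      have hsq : ((s.assigned.length : ℝ) + 1) * (s.models.length : ℝ) ^ 2 ≤
          ((s.assigned.length : ℝ) + 1 + 0) * ((s.models.length : ℝ) + 1) ^ 2 := by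
        rw [add_zero]
        gcongr
        linarith
      linarith

theorem incInv_of_reach [Finite I] {As M₀ : List (FSM I O)} {s : RunState I O}
    (hM₀ : M₀.Pairwise fun M N => ¬ M.Equivalent N)
    (h : Relation.ReflTransGen IncStep (RunState.start As M₀) s) : IncInv As M₀ s := by
  induction h with
  | refl =>
    refine ⟨partial_start As hM₀, trivial, fun n l _ _ _ => ?_⟩
    have := callBound_nonneg I n l
    simp only [RunState.start, Phase.active, List.length_nil, Nat.cast_zero, add_zero, zero_mul]
    exact ⟨by positivity, Nat.zero_le _⟩
  | tail _ h ih => exact ih.step h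

/-- `IncrementalFingerprinting` stops only when all implementations have been treated. -/
theorem IncInv.finished {As M₀ : List (FSM I O)} {s : RunState I O} (hs : IncInv As M₀ s)
    (h : ∀ s', ¬ IncStep s s') : s.todo = [] ∧ s.phase = .idle := by
  have hp := hs.phase
  match hph : s.phase with
  | .idle =>
    refine ⟨?_, rfl⟩
    match ht : s.todo with
    | [] => rfl
    | A :: Bs =>
      exfalso
      by_cases hm : s.models = []
      · exact h _ (.first s A Bs hph ht hm)
      obtain ⟨F, hF⟩ := exists_isSepSeq s.models
      have hlen := runFingerprint_length_le_one (A := A) hF hs.result.distinct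
      match hR : runFingerprint A s.models F with
      | ([], L) => exact h _ (.fpNone s A Bs F L hph ht hm hF hR)
      | ([M], L) => exact h _ (.fpSome s A Bs F L M hph ht hm hF hR)
      | (M :: N :: R, L) =>
        rw [hR] at hlen
        simp at hlen
  | .check M L =>
    rw [hph] at hp
    obtain ⟨A, Bs, ht, -⟩ := hp
    by_cases heq : A.Equivalent M
    · exact absurd (.pass s A Bs M L hph ht heq) (h _)
    · exact absurd (.fail s A Bs M L hph ht heq) (h _)
  | .call L =>
    rw [hph] at hp
    obtain ⟨A, Bs, ht, -⟩ := hp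
    exact absurd (.call s A Bs L [] hph ht (List.nil_subset _)) (h _)
  | .learn c =>
    rw [hph] at hp
    obtain ⟨A, Bs, ht, -, L, hr, -⟩ := hp
    exfalso
    by_cases hd : ∃ H, c.mode = .done H
    · obtain ⟨H, hd⟩ := hd
      exact h _ (.add s c H hph hd)
    · push Not at hd
      obtain ⟨c', hc'⟩ := hr.inv.exists_step hd
      exact h _ (.learn s A Bs c c' hph ht hc')

end IncFp

/-! ### The main theorem -/

open IncFp
theorem theorem2 :
    ∃ C : ℝ, ∀ (I : Type u) (O : Type v) [Finite I] (As : List (FSM I O)),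
      -- repeated `L#`
      (Terminates RepeatStep (RunState.start As []) ∧
        ∀ s, EndsIn RepeatStep (RunState.start As []) s →
          Correct As [] s ∧
          ∀ n l : ℕ, (∀ M ∈ s.models, M.size ≤ n) → (∀ ρ ∈ s.ces, ρ.length ≤ l) →
            (s.oq : ℝ) ≤ C * (As.length * (Nat.card I * (n : ℝ) ^ 2 + n * Real.log l)) ∧
            s.eq ≤ As.length * n) ∧
      -- `IncrementalFingerprinting` with `SepSeq` and `L#`
      ∀ M₀ : List (FSM I O), M₀.Pairwise (fun M N => ¬ M.Equivalent N) →
        Terminates IncStep (RunState.start As M₀) ∧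
        ∀ s, EndsIn IncStep (RunState.start As M₀) s →
          Correct As M₀ s ∧
          ∀ n l : ℕ, (∀ M ∈ s.models, M.size ≤ n) → (∀ ρ ∈ s.ces, ρ.length ≤ l) →
            (∀ w ∈ s.reused, w.length ≤ max l (2 * n)) →
            (s.oq : ℝ) ≤ C * (s.models.length * (Nat.card I * (n : ℝ) ^ 2 + n * Real.log l)
              + As.length * (s.models.length : ℝ) ^ 2) ∧
            s.eq ≤ s.models.length * n + As.length := by
  -- The constant is that of `query_bound`; the fingerprinting term needs only the factor `1`.
  refine ⟨50, fun I O _ As => ⟨⟨terminates_of_acc (acc_repeatStep _ _ rfl rfl), ?_⟩,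
    fun M₀ hM₀ => ⟨terminates_of_acc (acc_incStep _ _ rfl rfl), ?_⟩⟩⟩
  · rintro s ⟨hreach, hend⟩
    have hinv := repeatInv_of_reach hreach
    obtain ⟨ht, hp⟩ := hinv.finished hend
    refine ⟨⟨ht, hp, hinv.result.solves ht⟩, fun n l hn hl => ?_⟩
    have := hinv.cost n l hn hl
    rw [hinv.result.length_assigned ht, callBound] at this
    exact ⟨by linarith [this.1], this.2⟩
  · rintro s ⟨hreach, hend⟩
    have hinv := incInv_of_reach hM₀ hreach
    obtain ⟨ht, hp⟩ := hinv.finished hend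
    refine ⟨⟨ht, hp, hinv.result.solves ht⟩, fun n l hn hl hw => ?_⟩
    have := hinv.cost n l hn hl hw
    rw [hinv.result.length_assigned ht, callBound, hp] at this
    simp only [Phase.active, Phase.checked, add_zero] at this
    have h0 : (0 : ℝ) ≤ As.length * (s.models.length : ℝ) ^ 2 := by positivity
    exact ⟨by linarith [this.1], this.2⟩
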